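/- Let $\mathcal H=\mathbb C^d$ and $\mathcal H'=\mathbb C^{d'}$ be finite-dimensional Hilbert spaces. Let $\mathfrak A_\infty$ be the quasilocal $C^*$-algebra of the spin chain over $\mathbb Z$ with site algebra $\mathcal B(\mathcal H)$, i.e. the operator norm completion of the union of the local algebras $\mathfrak A_\Lambda=\bigotimes_{x\in\Lambda}\mathcal B(\mathcal H)$, $\Lambda\subset\mathbb Z$ finite, and let $\gamma$ be the automorphism of $\mathfrak A_\infty$ induced by the right shift of $\mathbb Z$. A state $\varphi$ on $\mathfrak A_\infty$ is stationary if $\varphi\circ\gamma=\varphi$. A stationary state is ergodic if it is an extremal point of the set of stationary states; it is weakly mixing if $\lim_{n\to\infty}\frac1n\sum_{i=1}^n|\varphi(a\,\gamma^i(b))-\varphi(a)\varphi(b)|=0$ for all $a,b\in\mathfrak A_\infty$; and it is strongly mixing if $\lim_{i\to\infty}\varphi(a\,\gamma^i(b))=\varphi(a)\varphi(b)$ for all $a,b\in\mathfrak A_\infty$. The same notions are used for the chain with site algebra $\mathcal B(\mathcal H')$. A source is a family $\{\rho_m\}_{m\ge1}$ of density operators $\rho_m\in\mathfrak A_{\{1,\dots,m\}}$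 which is consistent: $\operatorname{tr}(\rho_m a)=\operatorname{tr}(\rho_n(a\otimes I^{\otimes(n-m)}))$ for all $1\le m\le n$ and $a\in\mathfrak A_{\{1,\dots,m\}}$. A source is called stationary if there is a stationary state $\varphi$ on $\mathfrak A_\infty$ (necessarily unique) with $\varphi(a)=\operatorname{tr}(\rho_m a)$ for all $m\ge1$ and $a\in\mathfrak A_{\{1,\dots,m\}}$; it is called stationary and ergodic (respectively weakly mixing, strongly mixing) if this $\varphi$ is ergodic (respectively weakly mixing, strongly mixing). **Theorem.** Let $\mathcal E:\mathcal B(\mathcal H)\to\mathcal B(\mathcal H')$ be a trace-preserving completely positive linear map. If $\{\rho_m\}_{m\ge1}$ is a stationary source, then $\{\mathcal E^{\otimes m}(\rho_m)\}_{m\ge1}$ is again a stationary source (in particular a consistent family of density operators). If moreover $\{\rho_m\}_{m\ge1}$ is ergodic (respectively weakly mixing, strongly mixing), then so is $\{\mathcal E^{\otimes m}(\rho_m)\}_{m\ge1}$. -/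

import Mathlib

open scoped ComplexOrder

noncomputable section

namespace SpinChain

/-! ### Operators on `ℓ²(α)` -/

section Pullback

variable {α : Type*}

theorem pullback_sum_le (s : Set α) (τ : α → α) (hτ : Set.InjOn τ s)
    (f : lp (fun _ : α => ℂ) 2) (t : Finset α) :
    ∑ i ∈ t, ‖s.indicator (fun i => f (τ i)) i‖ ^ (2 : ENNReal).toReal
      ≤ ‖f‖ ^ (2 : ENNReal).toReal := by
  classical
  have h2 : (0 : ℝ) < (2 : ENNReal).toReal := by norm_num
  have h1 : ∑ i ∈ t, ‖s.indicator (fun i => f (τ i)) i‖ ^ (2 : ENNReal).toReal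
      = ∑ i ∈ t with i ∈ s, ‖f (τ i)‖ ^ (2 : ENNReal).toReal := by
    rw [Finset.sum_filter]
    refine Finset.sum_congr rfl fun i _ => ?_
    by_cases hi : i ∈ s
    · simp [hi]
    · simp [hi]
  rw [h1, ← Finset.sum_image (s := t.filter (· ∈ s)) (g := τ)
    (f := fun j => ‖f j‖ ^ (2 : ENNReal).toReal)]
  · exact lp.sum_rpow_le_norm_rpow h2 f _
  · intro a ha b hb hab
    simp only [Finset.coe_filter, Set.mem_ofPred_eq] at ha hb
    exact hτ ha.2 hb.2 hab

/-- The bounded operator `f ↦ 1_s · (f ∘ τ)` on `ℓ²(α)`, for a map `τ` that is injective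
on `s`. -/
def pullback (s : Set α) (τ : α → α) (hτ : Set.InjOn τ s) :
    lp (fun _ : α => ℂ) 2 →L[ℂ] lp (fun _ : α => ℂ) 2 :=
  LinearMap.mkContinuous
    { toFun := fun f => ⟨s.indicator (fun i => f (τ i)), memℓp_gen' (pullback_sum_le s τ hτ f)⟩
      map_add' := fun f g => by
        ext i
        change s.indicator (fun i => f (τ i) + g (τ i)) i = s.indicator (fun i => f (τ i)) i
          + s.indicator (fun i => g (τ i)) i
        by_cases hi : i ∈ s <;> simp [hi]
      map_smul' := fun c f => by
        ext i
        by_cases hi : i ∈ s <;> simp [hi] }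
    1 (fun f => by
      rw [one_mul]
      exact lp.norm_le_of_forall_sum_le (by norm_num) (norm_nonneg _) (pullback_sum_le s τ hτ f))

theorem pullback_apply (s : Set α) (τ : α → α) (hτ : Set.InjOn τ s)
    (f : lp (fun _ : α => ℂ) 2) (i : α) :
    pullback s τ hτ f i = s.indicator (fun i => f (τ i)) i := rfl

/-- The unitary operator `f ↦ f ∘ e` on `ℓ²(α)`, for a bijection `e` of `α`. -/
def pullbackEquiv (e : α ≃ α) : lp (fun _ : α => ℂ) 2 ≃ₗᵢ[ℂ] lp (fun _ : α => ℂ) 2 where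
  toFun := pullback Set.univ e e.injective.injOn
  invFun := pullback Set.univ e.symm e.symm.injective.injOn
  left_inv f := by ext i; simp [pullback_apply]
  right_inv f := by ext i; simp [pullback_apply]
  map_add' f g := by simp
  map_smul' c f := by simp
  norm_map' f := by
    have h2 : (0 : ℝ) < (2 : ENNReal).toReal := by norm_num
    change ‖pullback Set.univ e e.injective.injOn f‖ = ‖f‖
    rw [lp.norm_eq_tsum_rpow h2, lp.norm_eq_tsum_rpow h2]
    congr 1
    simp only [pullback_apply, Set.indicator_univ]
    exact e.tsum_eq (fun i => ‖f i‖ ^ (2 : ENNReal).toReal)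

theorem pullbackEquiv_apply (e : α ≃ α) (f : lp (fun _ : α => ℂ) 2) (i : α) :
    pullbackEquiv e f i = f (e i) := by
  change pullback Set.univ e e.injective.injOn f i = _
  simp [pullback_apply]

theorem pullbackEquiv_symm_apply (e : α ≃ α) (f : lp (fun _ : α => ℂ) 2) (i : α) :
    (pullbackEquiv e).symm f i = f (e.symm i) := by
  change pullback Set.univ e.symm e.symm.injective.injOn f i = _
  simp [pullback_apply]

end Pullback

/-! ### Local algebras and the quasilocal algebra -/

/-- Configurations of the chain: a basis label of `ℂ^d` at every site of `ℤ`. -/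
abbrev Config (d : ℕ) : Type := ℤ → Fin d

/-- The Hilbert space `ℓ²((Fin d)^ℤ)` on which all local observables act faithfully. -/
abbrev ConfigSpace (d : ℕ) : Type := lp (fun _ : Config d => ℂ) 2

/-- The local algebra `⨂_{x ∈ Λ} B(ℂ^d)` of a finite region `Λ ⊂ ℤ`, as the algebra of matrices
whose rows and columns are indexed by the product basis of `⨂_{x ∈ Λ} ℂ^d`. -/
abbrev LocalAlg (d : ℕ) (Λ : Finset ℤ) : Type := Matrix (Λ → Fin d) (Λ → Fin d) ℂ

variable {d : ℕ}

/-- Restriction of a configuration to `Λ`. -/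
def res (Λ : Finset ℤ) (ω : Config d) : Λ → Fin d := fun i => ω i

/-- The configuration that is `y` on `Λ` and `ω` off `Λ`. -/
def patch (Λ : Finset ℤ) (ω : Config d) (y : Λ → Fin d) : Config d :=
  fun i => if h : i ∈ Λ then y ⟨i, h⟩ else ω i

theorem res_patch (Λ : Finset ℤ) (ω : Config d) (y : Λ → Fin d) :
    res Λ (patch Λ ω y) = y := by
  funext i; simp [res, patch]

theorem patch_patch (Λ : Finset ℤ) (ω : Config d) (y z : Λ → Fin d) :
    patch Λ (patch Λ ω y) z = patch Λ ω z := by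
  funext i; by_cases h : i ∈ Λ <;> simp [patch, h]

theorem patch_res (Λ : Finset ℤ) (ω : Config d) : patch Λ ω (res Λ ω) = ω := by
  funext i; simp [patch, res]

theorem patch_eq_self {Λ : Finset ℤ} {ω : Config d} {y : Λ → Fin d} (h : res Λ ω = y) :
    patch Λ ω y = ω := by
  rw [← h, patch_res]

theorem patch_injOn (Λ : Finset ℤ) (x y : Λ → Fin d) :
    Set.InjOn (fun ω => patch Λ ω y) {ω | res Λ ω = x} := by
  intro ω hω η hη h
  have h' : patch Λ (patch Λ ω y) x = patch Λ (patch Λ η y) x := by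
    simp only at h
    rw [h]
  rw [patch_patch, patch_patch] at h'
  simp only [Set.mem_ofPred_eq] at hω hη
  rwa [← patch_res Λ ω, hω, ← patch_res Λ η, hη]

/-- The matrix unit `|x⟩⟨y| ⊗ 1` acting on `ℓ²((Fin d)^ℤ)`. -/
def unitOp (Λ : Finset ℤ) (x y : Λ → Fin d) : ConfigSpace d →L[ℂ] ConfigSpace d :=
  pullback {ω | res Λ ω = x} (fun ω => patch Λ ω y) (patch_injOn Λ x y)

theorem unitOp_apply (Λ : Finset ℤ) (x y : Λ → Fin d) (f : ConfigSpace d) (ω : Config d) :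
    unitOp Λ x y f ω = if res Λ ω = x then f (patch Λ ω y) else 0 := by
  simp [unitOp, pullback_apply, Set.indicator_apply]

/-- The operator `a ⊗ 1` on `ℓ²((Fin d)^ℤ)`, for `a` in the local algebra of `Λ`. -/
def localOp (Λ : Finset ℤ) (a : LocalAlg d Λ) : ConfigSpace d →L[ℂ] ConfigSpace d :=
  ∑ x, ∑ y, a x y • unitOp Λ x y

theorem localOp_apply (Λ : Finset ℤ) (a : LocalAlg d Λ) (f : ConfigSpace d) (ω : Config d) :
    localOp Λ a f ω = ∑ y, a (res Λ ω) y * f (patch Λ ω y) := by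
  have h : localOp Λ a f ω = ∑ x, ∑ y, a x y * unitOp Λ x y f ω := by
    simp only [localOp, sum_apply, smul_apply]
    rw [lp.coeFn_sum, Finset.sum_apply]
    refine Finset.sum_congr rfl fun x _ => ?_
    rw [lp.coeFn_sum, Finset.sum_apply]
    rfl
  rw [h, Finset.sum_eq_single (res Λ ω)]
  · simp [unitOp_apply]
  · intro x _ hx
    simp [unitOp_apply, hx.symm]
  · simp

theorem adjoint_unitOp (Λ : Finset ℤ) (x y : Λ → Fin d) :
    star (unitOp Λ x y) = unitOp Λ y x := by
  rw [ContinuousLinearMap.star_eq_adjoint]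
  symm
  rw [ContinuousLinearMap.eq_adjoint_iff]
  intro f g
  rw [lp.inner_eq_tsum, lp.inner_eq_tsum]
  simp only [unitOp_apply]
  let σ : {ω : Config d // res Λ ω = y} ≃ {ω : Config d // res Λ ω = x} :=
    { toFun := fun ω => ⟨patch Λ ω.1 x, res_patch _ _ _⟩
      invFun := fun ω => ⟨patch Λ ω.1 y, res_patch _ _ _⟩
      left_inv := fun ω => by
        ext1; simp only [patch_patch]; exact patch_eq_self ω.2
      right_inv := fun ω => by
        ext1; simp only [patch_patch]; exact patch_eq_self ω.2 }
  have h1 : (∑' ω : Config d, inner ℂ (if res Λ ω = y then f (patch Λ ω x) else 0) (g ω))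
      = ∑' ω : {ω : Config d // res Λ ω = y}, inner ℂ (f (patch Λ ω.1 x)) (g ω.1) := by
    have := tsum_subtype {ω : Config d | res Λ ω = y}
      (fun ω => inner ℂ (f (patch Λ ω x)) (g ω))
    refine Eq.trans ?_ this.symm
    refine tsum_congr fun ω => ?_
    by_cases h : res Λ ω = y <;> simp [h]
  have h2 : (∑' ω : Config d, inner ℂ (f ω) (if res Λ ω = x then g (patch Λ ω y) else 0))
      = ∑' ω : {ω : Config d // res Λ ω = x}, inner ℂ (f ω.1) (g (patch Λ ω.1 y)) := by
    have := tsum_subtype {ω : Config d | res Λ ω = x}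
      (fun ω => inner ℂ (f ω) (g (patch Λ ω y)))
    refine Eq.trans ?_ this.symm
    refine tsum_congr fun ω => ?_
    by_cases h : res Λ ω = x <;> simp [h]
  rw [h1, h2, ← σ.tsum_eq]
  refine tsum_congr fun ω => ?_
  change _ = inner ℂ (f (patch Λ ω.1 x)) (g (patch Λ (patch Λ ω.1 x) y))
  rw [patch_patch, patch_eq_self ω.2]

/-- `a ↦ a ⊗ 1` as a `*`-homomorphism from the local algebra of `Λ`. -/
def localHom (Λ : Finset ℤ) :
    LocalAlg d Λ →⋆ₐ[ℂ] (ConfigSpace d →L[ℂ] ConfigSpace d) where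
  toFun := localOp Λ
  map_one' := by
    ext f ω
    rw [localOp_apply, Finset.sum_eq_single (res Λ ω)]
    · simp [patch_res]
    · intro y _ hy
      simp [hy.symm]
    · simp
  map_mul' a b := by
    ext f ω
    rw [mul_apply_eq_comp, localOp_apply, localOp_apply]
    simp only [localOp_apply, res_patch, patch_patch, Matrix.mul_apply, Finset.sum_mul,
      Finset.mul_sum]
    rw [Finset.sum_comm]
    simp only [mul_assoc]
  map_zero' := by simp [localOp]
  map_add' a b := by simp [localOp, add_smul, Finset.sum_add_distrib]
  commutes' c := by
    ext f ω
    rw [localOp_apply, Finset.sum_eq_single (res Λ ω)]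
    · simp [patch_res, Matrix.algebraMap_matrix_apply, Algebra.algebraMap_eq_smul_one]
    · intro y _ hy
      simp [Matrix.algebraMap_matrix_apply, hy.symm]
    · simp
  map_star' a := by
    simp only [localOp, star_sum, star_smul, adjoint_unitOp, Matrix.star_apply]
    rw [Finset.sum_comm]

theorem localHom_apply (Λ : Finset ℤ) (a : LocalAlg d Λ) (f : ConfigSpace d) (ω : Config d) :
    localHom Λ a f ω = ∑ y, a (res Λ ω) y * f (patch Λ ω y) :=
  localOp_apply Λ a f ω

/-- The local algebras act faithfully, hence isometrically for their operator norms. -/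
theorem localHom_injective [NeZero d] (Λ : Finset ℤ) : Function.Injective (localHom (d := d) Λ) := by
  classical
  rw [injective_iff_map_eq_zero]
  intro a ha
  ext x y
  let ω : Config d := patch Λ (fun _ => 0) x
  have h := localHom_apply Λ a (lp.single 2 (patch Λ ω y) (1 : ℂ)) ω
  rw [ha, Finset.sum_eq_single y] at h
  · simpa [ω, res_patch] using h.symm
  · intro z _ hz
    have : patch Λ ω z ≠ patch Λ ω y := fun h' => hz (by
      rw [← res_patch Λ ω z, h', res_patch])
    simp [lp.single_apply, this]
  · simp

/-- The embedding `a ↦ a ⊗ 1` of the local algebra of `Λ` into that of a larger region. -/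
def ampliate {Λ Λ' : Finset ℤ} (h : Λ ⊆ Λ') (a : LocalAlg d Λ) : LocalAlg d Λ' :=
  open scoped Classical in
  Matrix.of fun x y =>
    if ∀ i : Λ', i.1 ∉ Λ → x i = y i then
      a (fun i => x ⟨i, h i.2⟩) (fun i => y ⟨i, h i.2⟩)
    else 0

/-- The embeddings of the local algebras into each other agree with their action. -/
theorem localHom_ampliate {Λ Λ' : Finset ℤ} (h : Λ ⊆ Λ') (a : LocalAlg d Λ) :
    localHom Λ' (ampliate h a) = localHom Λ a := by
  classical
  ext f ω
  rw [localHom_apply, localHom_apply]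
  let g : (Λ → Fin d) → (Λ' → Fin d) := fun y => res Λ' (patch Λ ω y)
  have hg : ∀ y, (fun i : Λ => g y ⟨i, h i.2⟩) = y := fun y => res_patch Λ ω y
  have hgi : Function.Injective g := fun y z hyz => by
    rw [← hg y, ← hg z, hyz]
  have hp : ∀ y, patch Λ' ω (g y) = patch Λ ω y := fun y => by
    funext i
    by_cases hi : i ∈ Λ'
    · simp [g, patch, res, hi]
    · have : i ∉ Λ := fun h' => hi (h h')
      simp [patch, hi, this]
  have key : ∀ y : Λ → Fin d, a (res Λ ω) y * f (patch Λ ω y)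
      = ampliate h a (res Λ' ω) (g y) * f (patch Λ' ω (g y)) := fun y => by
    rw [hp]
    congr 1
    have hc : ∀ i : Λ', i.1 ∉ Λ → res Λ' ω i = g y i := fun i hi => by
      simp [g, res, patch, hi]
    simp only [ampliate, Matrix.of_apply]
    rw [if_pos hc, hg y]
    rfl
  simp only [key]
  rw [← Finset.sum_image (s := Finset.univ) (g := g)
    (f := fun z => ampliate h a (res Λ' ω) z * f (patch Λ' ω z)) hgi.injOn]
  symm
  refine Finset.sum_subset (Finset.subset_univ _) fun z _ hz => ?_
  simp only [ampliate, Matrix.of_apply]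
  rw [if_neg, zero_mul]
  intro hc
  refine hz (Finset.mem_image.mpr ⟨fun i => z ⟨i, h i.2⟩, Finset.mem_univ _, ?_⟩)
  funext i
  by_cases hi : i.1 ∈ Λ
  · simp [g, res, patch, hi]
  · simpa [g, res, patch, hi] using hc i hi

/-- The quasilocal algebra, as a concrete C*-algebra: the operator norm closure of the (directed)
union of the local algebras of all finite regions. -/
def quasiLocal (d : ℕ) : StarSubalgebra ℂ (ConfigSpace d →L[ℂ] ConfigSpace d) :=
  (⨆ Λ : Finset ℤ, (localHom (d := d) Λ).range).topologicalClosure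

/-- The type of quasilocal observables. -/
abbrev QuasiLocal (d : ℕ) : Type := quasiLocal d

theorem localHom_mem (Λ : Finset ℤ) (a : LocalAlg d Λ) : localHom Λ a ∈ quasiLocal d :=
  StarSubalgebra.le_topologicalClosure _
    (le_iSup (fun Λ : Finset ℤ => (localHom (d := d) Λ).range) Λ ⟨a, rfl⟩)

/-- The inclusion of the local algebra of `Λ` in the quasilocal algebra. -/
def incl (Λ : Finset ℤ) : LocalAlg d Λ →⋆ₐ[ℂ] QuasiLocal d :=
  (localHom Λ).codRestrict (quasiLocal d) (localHom_mem Λ)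

/-! ### The shift -/

/-- The unitary implementing the right shift: it sends the basis vector of a configuration `η`
to the basis vector of the configuration `x ↦ η (x - 1)`. -/
def shiftUnitary (d : ℕ) : ConfigSpace d ≃ₗᵢ[ℂ] ConfigSpace d :=
  pullbackEquiv ((Equiv.addRight (1 : ℤ)).symm.arrowCongr (Equiv.refl (Fin d)))

theorem shiftUnitary_apply (f : ConfigSpace d) (ω : Config d) :
    shiftUnitary d f ω = f (fun x => ω (x + 1)) :=
  pullbackEquiv_apply _ _ _

theorem shiftUnitary_symm_apply (f : ConfigSpace d) (ω : Config d) :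
    (shiftUnitary d).symm f ω = f (fun x => ω (x - 1)) :=
  pullbackEquiv_symm_apply _ _ _

/-- The translate `Λ + 1` of a finite region. -/
def shiftRegion (Λ : Finset ℤ) : Finset ℤ := Λ.map (Equiv.addRight (1 : ℤ)).toEmbedding

theorem mem_shiftRegion {Λ : Finset ℤ} {x : ℤ} : x ∈ shiftRegion Λ ↔ x - 1 ∈ Λ := by
  simp only [shiftRegion, Finset.mem_map, Equiv.coe_toEmbedding, Equiv.coe_addRight]
  constructor
  · rintro ⟨y, hy, rfl⟩
    simpa using hy
  · intro h
    exact ⟨x - 1, h, by ring⟩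

/-- The bijection `x ↦ x + 1` from `Λ` to `Λ + 1`. -/
def siteEquiv (Λ : Finset ℤ) : Λ ≃ shiftRegion Λ where
  toFun i := ⟨i.1 + 1, mem_shiftRegion.mpr (by simp)⟩
  invFun i := ⟨i.1 - 1, mem_shiftRegion.mp i.2⟩
  left_inv i := by simp
  right_inv i := by simp

/-- The right shift moves a copy of `a` at `Λ` to the copy of `a` at `Λ + 1`. -/
theorem shift_localHom (Λ : Finset ℤ) (a : LocalAlg d Λ) :
    (shiftUnitary d).conjStarAlgEquiv (localHom Λ a)
      = localHom (shiftRegion Λ)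
          (Matrix.of fun x y => a (x ∘ siteEquiv Λ) (y ∘ siteEquiv Λ)) := by
  ext f ω
  rw [LinearIsometryEquiv.conjStarAlgEquiv_apply_apply, shiftUnitary_apply, localHom_apply,
    localHom_apply]
  rw [← ((siteEquiv Λ).arrowCongr (Equiv.refl (Fin d))).sum_comp]
  refine Finset.sum_congr rfl fun z _ => ?_
  rw [shiftUnitary_symm_apply]
  refine congr_arg₂ (· * ·) ?_ ?_
  · simp only [Matrix.of_apply]
    congr 1
    funext i
    simp [siteEquiv]
  · refine congrArg f ?_
    funext x
    by_cases hx : x - 1 ∈ Λ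
    · have hx' : x ∈ shiftRegion Λ := mem_shiftRegion.mpr hx
      simp [patch, hx, hx', siteEquiv]
    · have hx' : x ∉ shiftRegion Λ := fun h => hx (mem_shiftRegion.mp h)
      simp [patch, hx, hx']

theorem shift_mem (a : ConfigSpace d →L[ℂ] ConfigSpace d) (ha : a ∈ quasiLocal d) :
    (shiftUnitary d).conjStarAlgEquiv a ∈ quasiLocal d := by
  let γ : (ConfigSpace d →L[ℂ] ConfigSpace d) →⋆ₐ[ℂ] (ConfigSpace d →L[ℂ] ConfigSpace d) :=
    (shiftUnitary d).conjStarAlgEquiv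
  have hγ : Continuous γ := map_continuous γ
  have hle : quasiLocal d ≤ (quasiLocal d).comap γ := by
    refine StarSubalgebra.topologicalClosure_minimal (iSup_le fun Λ => ?_) ?_
    · rintro _ ⟨b, rfl⟩
      change (shiftUnitary d).conjStarAlgEquiv (localHom Λ b) ∈ quasiLocal d
      rw [shift_localHom]
      exact localHom_mem _ _
    · exact (StarSubalgebra.isClosed_topologicalClosure _).preimage hγ
  exact hle ha

/-- The endomorphism `γ` of the quasilocal algebra induced by the right shift of `ℤ`. -/
def shift (d : ℕ) : QuasiLocal d →⋆ₐ[ℂ] QuasiLocal d :=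
  (((shiftUnitary d).conjStarAlgEquiv : (ConfigSpace d →L[ℂ] ConfigSpace d) →⋆ₐ[ℂ]
      (ConfigSpace d →L[ℂ] ConfigSpace d)).comp (quasiLocal d).subtype).codRestrict
    (quasiLocal d) (fun a => shift_mem a.1 a.2)

/-- `γ` acts on local observables by translation of the region. -/
theorem shift_incl (Λ : Finset ℤ) (a : LocalAlg d Λ) :
    shift d (incl Λ a) = incl (shiftRegion Λ)
      (Matrix.of fun x y => a (x ∘ siteEquiv Λ) (y ∘ siteEquiv Λ)) :=
  Subtype.ext (shift_localHom Λ a)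

/-! ### States and their ergodic properties -/

/-- States of the infinite chain: positive normalized functionals. -/
structure IsState (φ : QuasiLocal d →L[ℂ] ℂ) : Prop where
  nonneg : ∀ a, 0 ≤ φ (star a * a)
  map_one : φ 1 = 1

/-- Stationary states: `φ ∘ γ = φ`. -/
structure IsStationaryState (φ : QuasiLocal d →L[ℂ] ℂ) : Prop where
  isState : IsState φ
  shift_invariant : ∀ a, φ (shift d a) = φ a

/-- Ergodic states: the extremal points of the set of stationary states. -/
def IsErgodicState (φ : QuasiLocal d →L[ℂ] ℂ) : Prop :=
  φ ∈ Set.extremePoints ℝ {ψ : QuasiLocal d →L[ℂ] ℂ | IsStationaryState ψ}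

/-- Weakly mixing states. -/
structure IsWeaklyMixingState (φ : QuasiLocal d →L[ℂ] ℂ) : Prop where
  isStationaryState : IsStationaryState φ
  tendsto : ∀ a b : QuasiLocal d, Filter.Tendsto
    (fun n : ℕ => (1 / (n : ℝ)) * ∑ i ∈ Finset.Icc 1 n, ‖φ (a * (shift d)^[i] b) - φ a * φ b‖)
    Filter.atTop (nhds 0)

/-- Strongly mixing states. -/
structure IsStronglyMixingState (φ : QuasiLocal d →L[ℂ] ℂ) : Prop where
  isStationaryState : IsStationaryState φ
  tendsto : ∀ a b : QuasiLocal d, Filter.Tendsto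
    (fun i : ℕ => φ (a * (shift d)^[i] b)) Filter.atTop (nhds (φ a * φ b))

/-! ### Sources as families of density operators -/

/-- The box `Λ(m) = {1, …, m}`. -/
def box (m : ℕ) : Finset ℤ := Finset.Icc 1 (m : ℤ)

theorem box_subset {m n : ℕ} (h : m ≤ n) : box m ⊆ box n :=
  Finset.Icc_subset_Icc_right (by exact_mod_cast h)

/-- Families `ρ_m` of elements of the local algebras of the boxes `{1, …, m}`; only the members
with `m ≥ 1` are used. -/
abbrev Family (d : ℕ) : Type := ∀ m : ℕ, LocalAlg d (box m)

/-- The consistency condition: `ρ_n` restricts to `ρ_m` for `m ≤ n`, that is,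
`tr (ρ_m a) = tr (ρ_n (a ⊗ 1))`. -/
def IsConsistent (ρ : Family d) : Prop :=
  ∀ m n : ℕ, 1 ≤ m → ∀ h : m ≤ n, ∀ a : LocalAlg d (box m),
    (ρ m * a).trace = (ρ n * ampliate (box_subset h) a).trace

/-- Sources: consistent families of density operators. -/
structure IsSource (ρ : Family d) : Prop where
  posSemidef : ∀ m, 1 ≤ m → (ρ m).PosSemidef
  trace_eq_one : ∀ m, 1 ≤ m → (ρ m).trace = 1
  consistent : IsConsistent ρ

/-- `ρ` is the family of density operators of the restrictions of `φ` to the boxes. -/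
def HasDensities (φ : QuasiLocal d →L[ℂ] ℂ) (ρ : Family d) : Prop :=
  ∀ m, 1 ≤ m → ∀ a : LocalAlg d (box m), φ (incl (box m) a) = (ρ m * a).trace

/-- `ρ` is a stationary source: it is consistent and belongs to a stationary state, which is then
unique. -/
def IsStationarySource (ρ : Family d) : Prop :=
  IsSource ρ ∧ ∃ φ : QuasiLocal d →L[ℂ] ℂ, HasDensities φ ρ ∧ IsStationaryState φ

/-- `ρ` is a stationary and ergodic source. -/
def IsErgodicSource (ρ : Family d) : Prop :=
  IsSource ρ ∧ ∃ φ : QuasiLocal d →L[ℂ] ℂ, HasDensities φ ρ ∧ IsErgodicState φ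

/-- `ρ` is a stationary and weakly mixing source. -/
def IsWeaklyMixingSource (ρ : Family d) : Prop :=
  IsSource ρ ∧ ∃ φ : QuasiLocal d →L[ℂ] ℂ, HasDensities φ ρ ∧ IsWeaklyMixingState φ

/-- `ρ` is a stationary and strongly mixing source. -/
def IsStronglyMixingSource (ρ : Family d) : Prop :=
  IsSource ρ ∧ ∃ φ : QuasiLocal d →L[ℂ] ℂ, HasDensities φ ρ ∧ IsStronglyMixingState φ

/-! ### Memoryless channels -/

section Channel

open scoped CStarAlgebra MatrixOrder Matrix.Norms.L2Operator

/-- Trace-preserving completely positive linear maps `B(ℂ^d) → B(ℂ^d')`. -/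
structure Channel (d d' : ℕ) extends
    CompletelyPositiveMap (Matrix (Fin d) (Fin d) ℂ) (Matrix (Fin d') (Fin d') ℂ) where
  trace_preserving : ∀ a, (toLinearMap a).trace = a.trace

/-- The underlying linear map of a channel. -/
def Channel.toLin {d d' : ℕ} (E : Channel d d') :
    Matrix (Fin d) (Fin d) ℂ →ₗ[ℂ] Matrix (Fin d') (Fin d') ℂ :=
  E.toLinearMap

end Channel

/-- The tensor power `E^{⊗ι} : B((ℂ^d)^{⊗ι}) → B((ℂ^d')^{⊗ι})` of a linear map `E` of matrices,
determined by `⨂ |x_i⟩⟨y_i| ↦ ⨂ E(|x_i⟩⟨y_i|)`. -/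
def tensorPower {d d' : ℕ} {ι : Type*} [Fintype ι] [DecidableEq ι]
    (E : Matrix (Fin d) (Fin d) ℂ →ₗ[ℂ] Matrix (Fin d') (Fin d') ℂ)
    (ρ : Matrix (ι → Fin d) (ι → Fin d) ℂ) : Matrix (ι → Fin d') (ι → Fin d') ℂ :=
  Matrix.of fun x' y' =>
    ∑ x, ∑ y, ρ x y * ∏ i, E (Matrix.single (x i) (y i) 1) (x' i) (y' i)

/-- `E^{⊗ι} (⨂ a_i) = ⨂ E(a_i)`. -/
theorem tensorPower_prod {d d' : ℕ} {ι : Type*} [Fintype ι] [DecidableEq ι]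
    (E : Matrix (Fin d) (Fin d) ℂ →ₗ[ℂ] Matrix (Fin d') (Fin d') ℂ)
    (a : ι → Matrix (Fin d) (Fin d) ℂ) :
    tensorPower E (Matrix.of fun x y => ∏ i, a i (x i) (y i))
      = Matrix.of fun x' y' => ∏ i, E (a i) (x' i) (y' i) := by
  ext x' y'
  simp only [tensorPower, Matrix.of_apply]
  have h : ∀ i, E (a i) (x' i) (y' i)
      = ∑ p, ∑ q, a i p q * E (Matrix.single p q 1) (x' i) (y' i) := fun i => by
    conv_lhs => rw [Matrix.matrix_eq_sum_single (a i)]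
    simp only [map_sum, Matrix.sum_apply]
    refine Finset.sum_congr rfl fun p _ => Finset.sum_congr rfl fun q _ => ?_
    have : Matrix.single p q (a i p q) = a i p q • Matrix.single p q (1 : ℂ) := by
      simp [Matrix.smul_single]
    rw [this, map_smul, Matrix.smul_apply, smul_eq_mul]
  simp only [h, Fintype.prod_sum, ← Finset.prod_mul_distrib]

/-- The output family `E^{⊗m}(ρ_m)` of the memoryless channel given by `E`. -/
def Channel.output {d d' : ℕ} (E : Channel d d') (ρ : Family d) : Family d' :=
  fun m => tensorPower E.toLin (ρ m)

end SpinChain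

end

open Filter Topology
open scoped ComplexOrder Matrix

noncomputable section

namespace SpinChain

section Abstract

variable {A : Type*} [CStarAlgebra A]

/-! ### Positive functionals -/

theorem map_star_of_nonneg {φ : A →L[ℂ] ℂ} (h : ∀ a, 0 ≤ φ (star a * a)) (a : A) :
    φ (star a) = star (φ a) := by
  have h0 := (Complex.nonneg_iff.mp (h a)).2
  have h1 := (Complex.nonneg_iff.mp (h (a + 1))).2
  have h2 := (Complex.nonneg_iff.mp (h (a + Complex.I • 1))).2
  have h3 := (Complex.nonneg_iff.mp (h 1)).2
  simp only [star_add, star_one, star_smul, mul_add, add_mul, mul_one, one_mul, map_add,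
    smul_mul_assoc, mul_smul_comm, map_smul, Complex.add_im, smul_eq_mul, Complex.mul_im,
    Complex.mul_re, Complex.star_def, Complex.conj_I, Complex.neg_im, Complex.neg_re,
    Complex.I_re, Complex.I_im] at h0 h1 h2 h3
  apply Complex.ext
  · simp only [Complex.star_def, Complex.conj_re]
    linarith
  · simp only [Complex.star_def, Complex.conj_im]
    linarith

theorem norm_sq_le_of_nonneg {φ : A →L[ℂ] ℂ} (h : ∀ a, 0 ≤ φ (star a * a)) (h1 : φ 1 = 1)
    (x : A) : ‖φ x‖ ^ 2 ≤ (φ (star x * x)).re := by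
  have h2 := (Complex.nonneg_iff.mp (h (x - φ x • 1))).1
  simp only [star_sub, star_smul, star_one, mul_sub, sub_mul, smul_mul_assoc, mul_smul_comm,
    one_mul, mul_one, map_sub, map_smul, h1, map_star_of_nonneg h, smul_eq_mul] at h2
  rw [← Complex.normSq_eq_norm_sq, Complex.normSq_apply]
  simp only [Complex.star_def, Complex.sub_re, Complex.mul_re, Complex.conj_re,
    Complex.conj_im] at h2
  linarith

theorem exists_one_add_eq_star_mul_self {s : A} (hs : IsSelfAdjoint s) (h : ‖s‖ ≤ 1) :
    ∃ c, 1 + s = star c * c := by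
  let _ := CStarAlgebra.spectralOrder A
  have _ := CStarAlgebra.spectralOrderedRing A
  rw [← CStarAlgebra.nonneg_iff_eq_star_mul_self]
  have h1 := hs.neg_algebraMap_norm_le_self
  have h2 : algebraMap ℝ A ‖s‖ ≤ 1 := by
    rw [← map_one (algebraMap ℝ A)]
    exact algebraMap_mono A h
  have h3 : -(1 : A) ≤ s := (neg_le_neg h2).trans h1
  simpa using add_le_add_right h3 1

theorem norm_iterate_le (γ : A →⋆ₐ[ℂ] A) (n : ℕ) (a : A) : ‖γ^[n] a‖ ≤ ‖a‖ := by
  induction n generalizing a with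
  | zero => exact le_rfl
  | succ n ih => exact (ih (γ a)).trans (NonUnitalStarAlgHom.norm_apply_le γ a)

theorem iterate_star (γ : A →⋆ₐ[ℂ] A) (n : ℕ) (a : A) : γ^[n] (star a) = star (γ^[n] a) := by
  induction n generalizing a with
  | zero => rfl
  | succ n ih => rw [Function.iterate_succ_apply, map_star, ih, Function.iterate_succ_apply]

/-! ### Time averages -/

/-- The average `n⁻¹ ∑_{i < n} γ^i b`. -/
def timeAvg (γ : A →⋆ₐ[ℂ] A) (n : ℕ) (b : A) : A :=
  (n : ℂ)⁻¹ • ∑ i ∈ Finset.range n, γ^[i] b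

variable (γ : A →⋆ₐ[ℂ] A)

theorem timeAvg_add (n : ℕ) (a b : A) : timeAvg γ n (a + b) = timeAvg γ n a + timeAvg γ n b := by
  simp [timeAvg, iterate_map_add, Finset.sum_add_distrib]

theorem iterate_map_complex_smul (n : ℕ) (c : ℂ) (a : A) : γ^[n] (c • a) = c • γ^[n] a := by
  induction n generalizing a with
  | zero => rfl
  | succ n ih => rw [Function.iterate_succ_apply, map_smul, ih, Function.iterate_succ_apply]

theorem timeAvg_smul (n : ℕ) (c : ℂ) (a : A) : timeAvg γ n (c • a) = c • timeAvg γ n a := by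
  simp only [timeAvg, iterate_map_complex_smul, ← Finset.smul_sum, smul_comm c]

theorem timeAvg_one {n : ℕ} (hn : n ≠ 0) : timeAvg γ n 1 = 1 := by
  have : (n : ℂ) ≠ 0 := by exact_mod_cast hn
  simp only [timeAvg, iterate_map_one, Finset.sum_const, Finset.card_range]
  rw [← Nat.cast_smul_eq_nsmul ℂ, inv_smul_smul₀ this]

theorem norm_timeAvg_le (n : ℕ) (b : A) : ‖timeAvg γ n b‖ ≤ ‖b‖ := by
  rcases eq_or_ne n 0 with rfl | hn
  · simp [timeAvg]
  · have hn' : (0 : ℝ) < n := by positivity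
    rw [timeAvg, norm_smul, norm_inv, Complex.norm_natCast, inv_mul_le_iff₀ hn']
    refine (norm_sum_le _ _).trans ((Finset.sum_le_sum fun i _ => norm_iterate_le γ i b).trans ?_)
    simp

theorem norm_map_timeAvg_sub_le (n : ℕ) (b : A) :
    ‖γ (timeAvg γ n b) - timeAvg γ n b‖ ≤ 2 * ‖b‖ * (n : ℝ)⁻¹ := by
  have h : γ (timeAvg γ n b) - timeAvg γ n b = (n : ℂ)⁻¹ • (γ^[n] b - b) := by
    rw [timeAvg, map_smul, map_sum, ← smul_sub, ← Finset.sum_sub_distrib]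
    simp only [← Function.iterate_succ_apply' γ]
    rw [Finset.sum_range_sub (fun i => γ^[i] b)]
    rfl
  rw [h, norm_smul, norm_inv, Complex.norm_natCast, mul_comm]
  gcongr
  refine (norm_sub_le _ _).trans ?_
  linarith [norm_iterate_le γ n b]

/-- Cesàro means of a null sequence in a normed space are null. -/
theorem tendsto_cesaro_zero {E : Type*} [NormedAddCommGroup E] [NormedSpace ℂ E] {u : ℕ → E}
    (hu : Tendsto u atTop (𝓝 0)) :
    Tendsto (fun n : ℕ => (n : ℂ)⁻¹ • ∑ i ∈ Finset.range n, u i) atTop (𝓝 0) := by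
  refine squeeze_zero_norm (fun n => ?_) (hu.norm.cesaro.trans (by simp))
  rw [norm_smul, norm_inv, Complex.norm_natCast]
  gcongr
  exact norm_sum_le _ _

theorem tendsto_timeAvg_commutator
    (hcomm : ∀ a b : A, Tendsto (fun n => a * γ^[n] b - γ^[n] b * a) atTop (𝓝 0)) (a b : A) :
    Tendsto (fun n => a * timeAvg γ n b - timeAvg γ n b * a) atTop (𝓝 0) := by
  refine (tendsto_cesaro_zero (hcomm a b)).congr fun n => ?_
  simp only [timeAvg, mul_smul_comm, smul_mul_assoc, Finset.mul_sum, Finset.sum_mul, ← smul_sub,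
    ← Finset.sum_sub_distrib]

variable {γ}

theorem map_iterate {φ : A →L[ℂ] ℂ} (hγ : ∀ a, φ (γ a) = φ a) (n : ℕ) (a : A) :
    φ (γ^[n] a) = φ a := by
  induction n generalizing a with
  | zero => rfl
  | succ n ih => rw [Function.iterate_succ_apply, ih, hγ]

theorem map_timeAvg {φ : A →L[ℂ] ℂ} (hγ : ∀ a, φ (γ a) = φ a) {n : ℕ} (hn : n ≠ 0) (a : A) :
    φ (timeAvg γ n a) = φ a := by
  have : (n : ℂ) ≠ 0 := by exact_mod_cast hn
  simp only [timeAvg, map_smul, map_sum, map_iterate hγ, Finset.sum_const, Finset.card_range,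
    nsmul_eq_mul, smul_eq_mul]
  rw [inv_mul_cancel_left₀ this]

/-! ### Extremal invariant states cluster in the mean -/

/-- The `γ`-invariant states of a C⋆-algebra. -/
def invariantStates (γ : A →⋆ₐ[ℂ] A) : Set (A →L[ℂ] ℂ) :=
  {φ | (∀ a, 0 ≤ φ (star a * a)) ∧ φ 1 = 1 ∧ ∀ a, φ (γ a) = φ a}

/-- Along an ultrafilter, the functionals `a ↦ φ (a * timeAvg γ n b)` converge. -/
theorem exists_tendsto_ultrafilter (γ : A →⋆ₐ[ℂ] A) (φ : A →L[ℂ] ℂ) (U : Ultrafilter ℕ) (b : A) :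
    ∃ ψ : A →L[ℂ] ℂ, ∀ a, Tendsto (fun n => φ (a * timeAvg γ n b)) U (𝓝 (ψ a)) := by
  have hb : ∀ a n, ‖φ (a * timeAvg γ n b)‖ ≤ (‖φ‖ * ‖b‖) * ‖a‖ := fun a n => by
    refine (φ.le_opNorm _).trans ?_
    rw [mul_assoc]
    gcongr
    refine (norm_mul_le _ _).trans ?_
    rw [mul_comm]
    gcongr
    exact norm_timeAvg_le γ n b
  have hex : ∀ a, ∃ l, Tendsto (fun n => φ (a * timeAvg γ n b)) U (𝓝 l) ∧
      ‖l‖ ≤ (‖φ‖ * ‖b‖) * ‖a‖ := fun a => by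
    obtain ⟨l, hl, hle⟩ := (isCompact_closedBall (0 : ℂ) ((‖φ‖ * ‖b‖) * ‖a‖)).ultrafilter_le_nhds
      (U.map fun n => φ (a * timeAvg γ n b)) (by
        rw [le_principal_iff]
        refine Filter.mem_map.mpr (Filter.univ_mem' fun n => ?_)
        simpa using hb a n)
    exact ⟨l, hle, by simpa using hl⟩
  choose L hL hLn using hex
  refine ⟨LinearMap.mkContinuous ⟨⟨L, fun a a' => ?_⟩, fun c a => ?_⟩ _ hLn, hL⟩
  · refine tendsto_nhds_unique (hL _) (((hL a).add (hL a')).congr fun n => ?_)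
    rw [add_mul, map_add]
  · refine tendsto_nhds_unique (hL _) (((hL a).const_smul c).congr fun n => ?_)
    rw [smul_mul_assoc, map_smul]

theorem ultrafilter_limit_nonneg
    (hcomm : ∀ a b : A, Tendsto (fun n => a * γ^[n] b - γ^[n] b * a) atTop (𝓝 0))
    {φ ψ : A →L[ℂ] ℂ} (hφ : ∀ a, 0 ≤ φ (star a * a)) {U : Ultrafilter ℕ}
    (hU : (U : Filter ℕ) ≤ atTop) {c : A}
    (hψ : ∀ a, Tendsto (fun n => φ (a * timeAvg γ n (star c * c))) U (𝓝 (ψ a))) (a : A) :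
    0 ≤ ψ (star a * a) := by
  have h1 : Tendsto (fun n => φ (star a * timeAvg γ n (star c * c) * a)) U
      (𝓝 (ψ (star a * a))) := by
    have h2 : Tendsto (fun n => φ (star a * (a * timeAvg γ n (star c * c)
        - timeAvg γ n (star c * c) * a))) atTop (𝓝 0) := by
      have := (tendsto_timeAvg_commutator γ hcomm a (star c * c)).const_mul (star a)
      rw [mul_zero] at this
      simpa [Function.comp_def] using (φ.continuous.tendsto 0).comp this
    have h3 := (hψ (star a * a)).sub (h2.mono_left hU)
    rw [sub_zero] at h3
    refine h3.congr fun n => ?_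
    rw [mul_sub, map_sub, mul_assoc, mul_assoc, sub_sub_cancel]
  refine ge_of_tendsto h1 (Eventually.of_forall fun n => ?_)
  have h4 : φ (star a * timeAvg γ n (star c * c) * a)
      = (n : ℂ)⁻¹ * ∑ i ∈ Finset.range n, φ (star (γ^[i] c * a) * (γ^[i] c * a)) := by
    simp only [timeAvg, mul_smul_comm, smul_mul_assoc, map_smul, Finset.mul_sum, Finset.sum_mul,
      map_sum, smul_eq_mul, star_mul, ← iterate_star, iterate_map_mul, mul_assoc]
  rw [h4]
  refine mul_nonneg ?_ (Finset.sum_nonneg fun i _ => hφ _)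
  rw [inv_nonneg]
  exact Nat.cast_nonneg n

theorem ultrafilter_limit_invariant {φ ψ : A →L[ℂ] ℂ} (hγ : ∀ a, φ (γ a) = φ a)
    {U : Ultrafilter ℕ} (hU : (U : Filter ℕ) ≤ atTop) {b : A}
    (hψ : ∀ a, Tendsto (fun n => φ (a * timeAvg γ n b)) U (𝓝 (ψ a))) (a : A) :
    ψ (γ a) = ψ a := by
  have h0 : Tendsto (fun n => γ (timeAvg γ n b) - timeAvg γ n b) atTop (𝓝 0) := by
    refine squeeze_zero_norm (fun n => norm_map_timeAvg_sub_le γ n b) ?_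
    simpa using tendsto_inv_atTop_nhds_zero_nat (𝕜 := ℝ).const_mul (2 * ‖b‖)
  have h1 : Tendsto (fun n => φ (γ a * (γ (timeAvg γ n b) - timeAvg γ n b))) U (𝓝 0) := by
    have := (h0.const_mul (γ a)).mono_left hU
    rw [mul_zero] at this
    simpa [Function.comp_def] using (φ.continuous.tendsto 0).comp this
  refine tendsto_nhds_unique (hψ (γ a)) ?_
  have h2 := (hψ a).sub h1
  rw [sub_zero] at h2
  refine h2.congr fun n => ?_
  rw [mul_sub, map_sub, ← map_mul, hγ, sub_sub_cancel]

theorem eq_smul_of_extreme {φ ψ χ : A →L[ℂ] ℂ} (hφ : φ ∈ Set.extremePoints ℝ (invariantStates γ))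
    (hψ : ∀ a, 0 ≤ ψ (star a * a)) (hχ : ∀ a, 0 ≤ χ (star a * a))
    (hψγ : ∀ a, ψ (γ a) = ψ a) (hχγ : ∀ a, χ (γ a) = χ a) (h : ∀ a, ψ a + χ a = φ a)
    (hψ0 : ψ 1 ≠ 0) (hχ0 : χ 1 ≠ 0) (a : A) : ψ a = φ a * ψ 1 := by
  have key : ∀ {η : A →L[ℂ] ℂ}, (∀ a, 0 ≤ η (star a * a)) → (∀ a, η (γ a) = η a) → η 1 ≠ 0 →
      ∃ t : ℝ, 0 < t ∧ η 1 = t ∧ (t⁻¹ : ℂ) • η ∈ invariantStates γ := by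
    intro η h1 h2 h3
    have h4 : 0 ≤ η 1 := by simpa using h1 1
    obtain ⟨h5, h6⟩ := Complex.nonneg_iff.mp h4
    have h7 : η 1 = ((η 1).re : ℂ) := Complex.ext (by simp) (by simp [← h6])
    refine ⟨(η 1).re, lt_of_le_of_ne h5 fun h8 => h3 ?_, h7, fun a => ?_, ?_, fun a => ?_⟩
    · rw [h7, ← h8]; simp
    · rw [smul_apply, smul_eq_mul]
      refine mul_nonneg ?_ (h1 a)
      rw [← Complex.ofReal_inv]
      exact_mod_cast inv_nonneg.mpr h5
    · rw [smul_apply, smul_eq_mul, ← h7, inv_mul_cancel₀ h3]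
    · rw [smul_apply, smul_apply, h2]
  obtain ⟨s, hs, hs1, hs2⟩ := key hψ hψγ hψ0
  obtain ⟨t, ht, ht1, ht2⟩ := key hχ hχγ hχ0
  have hst : s + t = 1 := by
    have := h 1
    rw [hs1, ht1, hφ.1.2.1] at this
    exact_mod_cast this
  have hsc : (s : ℂ) ≠ 0 := by exact_mod_cast hs.ne'
  have htc : (t : ℂ) ≠ 0 := by exact_mod_cast ht.ne'
  have h1 := (mem_extremePoints.mp hφ).2 _ hs2 _ ht2 ⟨s, t, hs, ht, hst, by
    ext a
    simp only [add_apply, smul_apply, Complex.real_smul, smul_eq_mul, mul_inv_cancel_left₀ hsc,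
      mul_inv_cancel_left₀ htc, h]⟩
  rw [← h1.1, hs1, smul_apply, smul_eq_mul, mul_comm, mul_inv_cancel_left₀ hsc]

theorem tendsto_timeAvg_of_extreme
    (hcomm : ∀ a b : A, Tendsto (fun n => a * γ^[n] b - γ^[n] b * a) atTop (𝓝 0))
    {φ : A →L[ℂ] ℂ} (hφ : φ ∈ Set.extremePoints ℝ (invariantStates γ)) (a b : A) :
    Tendsto (fun n => φ (a * timeAvg γ n b)) atTop (𝓝 (φ a * φ b)) := by
  rw [tendsto_iff_ultrafilter]
  intro U hU
  obtain ⟨hpos, hone, hinv⟩ := hφ.1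
  have hne : ∀ᶠ n in (U : Filter ℕ), n ≠ 0 := hU (eventually_ne_atTop 0)
  let P : A → Prop := fun b => ∀ a, Tendsto (fun n => φ (a * timeAvg γ n b)) U (𝓝 (φ a * φ b))
  have hadd : ∀ b b', P b → P b' → P (b + b') := fun b b' h h' a => by
    simpa only [timeAvg_add, mul_add, map_add] using (h a).add (h' a)
  have hsmul : ∀ (c : ℂ) b, P b → P (c • b) := fun c b h a => by
    simpa only [timeAvg_smul, mul_smul_comm, map_smul, smul_eq_mul, mul_left_comm] using
      (h a).const_mul c
  have hP1 : P 1 := fun a => by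
    rw [hone, mul_one]
    refine tendsto_const_nhds.congr' ?_
    filter_upwards [hne] with n hn
    rw [timeAvg_one γ hn, mul_one]
  have hsmall : ∀ s, IsSelfAdjoint s → ‖s‖ ≤ 1 → ‖φ s‖ ≤ 1 / 2 → P s := by
    intro s hs h1 h2
    obtain ⟨c, hc⟩ := exists_one_add_eq_star_mul_self hs h1
    obtain ⟨e, he⟩ := exists_one_add_eq_star_mul_self hs.neg (by rwa [norm_neg])
    obtain ⟨ψ, hψ⟩ := exists_tendsto_ultrafilter γ φ U (star c * c)
    obtain ⟨χ, hχ⟩ := exists_tendsto_ultrafilter γ φ U (star e * e)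
    have hval : ∀ {η : A →L[ℂ] ℂ} {x : A},
        (∀ a, Tendsto (fun n => φ (a * timeAvg γ n x)) U (𝓝 (η a))) → η 1 = φ x := by
      intro η x h
      refine tendsto_nhds_unique (h 1) (tendsto_const_nhds.congr' ?_)
      filter_upwards [hne] with n hn
      rw [one_mul, map_timeAvg hinv hn]
    have hψ1 : ψ 1 = 1 + φ s := by rw [hval hψ, ← hc, map_add, hone]
    have hχ1 : χ 1 = 1 - φ s := by rw [hval hχ, ← he, map_add, map_neg, hone, sub_eq_add_neg]
    have hsum : ∀ a, ψ a + χ a = 2 * φ a := fun a => by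
      refine tendsto_nhds_unique ((hψ a).add (hχ a)) (tendsto_const_nhds.congr' ?_)
      filter_upwards [hne] with n hn
      rw [← map_add, ← mul_add, ← timeAvg_add, ← hc, ← he, add_add_add_comm, add_neg_cancel,
        add_zero, timeAvg_add, timeAvg_one γ hn, mul_add, mul_one, map_add, two_mul]
    have hn1 : ∀ z : ℂ, ‖z‖ ≤ 1 / 2 → 1 + z ≠ 0 := fun z hz h0 => by
      have : z = -1 := by linear_combination h0
      rw [this, norm_neg, norm_one] at hz
      norm_num at hz
    have hhalf : (0 : ℂ) ≤ 2⁻¹ := by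
      rw [inv_nonneg]; exact zero_le_two
    have hψφ := eq_smul_of_extreme hφ (ψ := (2⁻¹ : ℂ) • ψ) (χ := (2⁻¹ : ℂ) • χ)
      (fun a => mul_nonneg hhalf (ultrafilter_limit_nonneg hcomm hpos hU hψ a))
      (fun a => mul_nonneg hhalf (ultrafilter_limit_nonneg hcomm hpos hU hχ a))
      (fun a => by rw [smul_apply, smul_apply, ultrafilter_limit_invariant hinv hU hψ])
      (fun a => by rw [smul_apply, smul_apply, ultrafilter_limit_invariant hinv hU hχ])
      (fun a => by
        rw [smul_apply, smul_apply, ← smul_add, hsum, smul_eq_mul]; ring)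
      (by
        rw [smul_apply, hψ1, smul_eq_mul]
        exact mul_ne_zero (by norm_num) (hn1 _ h2))
      (by
        rw [smul_apply, hχ1, smul_eq_mul, sub_eq_add_neg]
        exact mul_ne_zero (by norm_num) (hn1 _ (by rwa [norm_neg])))
    have hPc : P (star c * c) := fun a => by
      have h3 := hψφ a
      simp only [smul_apply, smul_eq_mul] at h3
      have h4 : ψ a = φ a * φ (star c * c) := by
        rw [← hval hψ]; linear_combination 2 * h3
      rw [← h4]
      exact hψ a
    have h5 : s = star c * c + (-1 : ℂ) • 1 := by rw [← hc]; simp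
    rw [h5]
    exact hadd _ _ hPc (hsmul _ _ hP1)
  have hsa : ∀ s, IsSelfAdjoint s → P s := by
    intro s hs
    let r : ℝ := 2 * (‖φ‖ + 1) * (‖s‖ + 1)
    have hr : 0 < r := by positivity
    have hrc : (r : ℂ) ≠ 0 := by exact_mod_cast hr.ne'
    have h1 : s = (r : ℂ) • ((r⁻¹ : ℝ) : ℂ) • s := by
      rw [Complex.ofReal_inv, smul_inv_smul₀ hrc]
    rw [h1]
    have hrs : IsSelfAdjoint ((r⁻¹ : ℝ) : ℂ) := Complex.conj_ofReal _
    refine hsmul _ _ (hsmall _ (hrs.smul hs) ?_ ?_)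
    · rw [norm_smul, Complex.norm_real, Real.norm_of_nonneg (by positivity), inv_mul_le_iff₀ hr]
      nlinarith [norm_nonneg φ, norm_nonneg s]
    · rw [map_smul, norm_smul, Complex.norm_real, Real.norm_of_nonneg (by positivity),
        inv_mul_le_iff₀ hr]
      refine (φ.le_opNorm s).trans ?_
      nlinarith [norm_nonneg φ, norm_nonneg s, mul_nonneg (norm_nonneg φ) (norm_nonneg s)]
  have hall : P b := by
    rw [← realPart_add_I_smul_imaginaryPart b]
    exact hadd _ _ (hsa _ (realPart b).2) (hsmul _ _ (hsa _ (imaginaryPart b).2))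
  exact hall a

/-! ### Clustering in the mean implies extremality -/

theorem tendsto_div_sq_of_diff {V g : ℕ → ℝ} {L c : ℝ} (h0 : V 0 = 0)
    (hV : ∀ n : ℕ, V (n + 1) = V n + (2 * ((n + 1 : ℕ) * g (n + 1)) - c))
    (hg : Tendsto g atTop (𝓝 L)) :
    Tendsto (fun n : ℕ => V n / (n : ℝ) ^ 2) atTop (𝓝 L) := by
  have hsum : ∀ n : ℕ, ∑ m ∈ Finset.range n, ((m : ℝ) + 1) = n * (n + 1) / 2 := fun n => by
    induction n with
    | zero => simp
    | succ n ih => rw [Finset.sum_range_succ, ih]; push_cast; ring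
  have hVs : ∀ n : ℕ, ∑ m ∈ Finset.range n, (V (m + 1) - V m - 2 * L * ((m : ℝ) + 1))
      = V n - L * (n * (n + 1)) := fun n => by
    rw [Finset.sum_sub_distrib, Finset.sum_range_sub, h0, ← Finset.mul_sum, hsum]; ring
  have hinv : Tendsto (fun m : ℕ => ((m : ℝ) + 1)⁻¹) atTop (𝓝 0) := by
    simpa using tendsto_one_div_add_atTop_nhds_zero_nat (𝕜 := ℝ)
  have ho : (fun m : ℕ => V (m + 1) - V m - 2 * L * ((m : ℝ) + 1))
      =o[atTop] fun m : ℕ => (m : ℝ) + 1 := by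
    refine (Asymptotics.isLittleO_iff_tendsto fun m hm => ?_).mpr ?_
    · exact absurd hm (by positivity)
    · have h1 : Tendsto (fun m : ℕ => 2 * (g (m + 1) - L) - c * ((m : ℝ) + 1)⁻¹) atTop
          (𝓝 (2 * (L - L) - c * 0)) :=
        ((((tendsto_add_atTop_iff_nat 1).mpr hg).sub_const L).const_mul 2).sub (hinv.const_mul c)
      rw [sub_self, mul_zero, mul_zero, sub_zero] at h1
      refine h1.congr fun m => ?_
      have : (m : ℝ) + 1 ≠ 0 := by positivity
      rw [hV]
      push_cast
      field_simp
      ring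
  have hdiv : Tendsto (fun n : ℕ => ∑ m ∈ Finset.range n, ((m : ℝ) + 1)) atTop atTop := by
    refine tendsto_atTop_mono (fun n => ?_) tendsto_natCast_atTop_atTop
    calc (n : ℝ) = ∑ m ∈ Finset.range n, (1 : ℝ) := by simp
      _ ≤ _ := Finset.sum_le_sum fun m _ => by linarith [(Nat.cast_nonneg m : (0 : ℝ) ≤ m)]
  have hs := (ho.sum_range (fun m => by positivity) hdiv).tendsto_div_nhds_zero
  have hr : Tendsto (fun n : ℕ => 1 + (n : ℝ)⁻¹) atTop (𝓝 1) := by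
    simpa using (tendsto_inv_atTop_nhds_zero_nat (𝕜 := ℝ)).const_add 1
  have hfin := ((hs.mul hr).mul_const (1 / 2)).add (hr.const_mul L)
  rw [zero_mul, zero_mul, zero_add, mul_one] at hfin
  refine hfin.congr' ?_
  filter_upwards [eventually_ne_atTop 0] with n hn
  have hn' : (n : ℝ) ≠ 0 := by exact_mod_cast hn
  have hn1 : (n : ℝ) + 1 ≠ 0 := by positivity
  rw [hVs, hsum]
  field_simp
  ring

theorem tendsto_timeAvg_star_mul_self {φ : A →L[ℂ] ℂ} (hφ : φ ∈ invariantStates γ) (b : A)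
    (hb : Tendsto (fun n => φ (star b * timeAvg γ n b)) atTop (𝓝 (φ (star b) * φ b))) :
    Tendsto (fun n => (φ (star (timeAvg γ n b) * timeAvg γ n b)).re) atTop (𝓝 (‖φ b‖ ^ 2)) := by
  obtain ⟨hpos, hone, hinv⟩ := hφ
  let S : ℕ → A := fun n => ∑ i ∈ Finset.range n, γ^[i] b
  have hS : ∀ n : ℕ, n ≠ 0 → S n = (n : ℂ) • timeAvg γ n b := fun n hn => by
    have : (n : ℂ) ≠ 0 := by exact_mod_cast hn
    rw [timeAvg, smul_inv_smul₀ this]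
  have hcross : ∀ n, φ (star (S n) * γ^[n] b) = φ (star b * S (n + 1)) - φ (star b * b) := by
    intro n
    have h1 : ∀ i ∈ Finset.range n, φ (star (γ^[i] b) * γ^[n] b)
        = φ (star b * γ^[n - 1 - i + 1] b) := fun i hi => by
      have hi' : n = i + (n - 1 - i + 1) := by have := Finset.mem_range.mp hi; omega
      conv_lhs => rw [hi', Function.iterate_add_apply, ← iterate_star, ← iterate_map_mul,
        map_iterate hinv]
    simp only [S, star_sum, Finset.sum_mul, map_sum, Finset.mul_sum]
    rw [Finset.sum_congr rfl h1, Finset.sum_range_reflect (fun k => φ (star b * γ^[k + 1] b)),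
      Finset.sum_range_succ' (fun k => φ (star b * γ^[k] b))]
    simp
  have hV : ∀ n : ℕ, (φ (star (S (n + 1)) * S (n + 1))).re = (φ (star (S n) * S n)).re
      + (2 * ((n + 1 : ℕ) * (φ (star b * timeAvg γ (n + 1) b)).re) - (φ (star b * b)).re) := by
    intro n
    have h1 : S (n + 1) = S n + γ^[n] b := Finset.sum_range_succ _ _
    have h2 : (φ (star (γ^[n] b) * S n)).re = (φ (star (S n) * γ^[n] b)).re := by
      rw [← star_star (S n), ← star_mul, star_star, map_star_of_nonneg hpos]
      simp
    have h3 : φ (star (γ^[n] b) * γ^[n] b) = φ (star b * b) := by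
      rw [← iterate_star, ← iterate_map_mul, map_iterate hinv]
    have h4 := hcross n
    rw [hS _ n.succ_ne_zero, mul_smul_comm, map_smul] at h4
    rw [h1, star_add, add_mul, mul_add, mul_add, map_add, map_add, map_add, h3, Complex.add_re,
      Complex.add_re, Complex.add_re, h2, h4, Complex.sub_re, smul_eq_mul, ← Complex.ofReal_natCast,
      Complex.re_ofReal_mul]
    ring
  have hL : (φ (star b) * φ b).re = ‖φ b‖ ^ 2 := by
    rw [map_star_of_nonneg hpos, ← Complex.normSq_eq_norm_sq, Complex.star_def,
      ← Complex.normSq_eq_conj_mul_self, Complex.ofReal_re]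
  have hre := (Complex.continuous_re.tendsto _).comp hb
  rw [hL] at hre
  refine (tendsto_div_sq_of_diff (V := fun n => (φ (star (S n) * S n)).re) (by simp [S]) hV
    hre).congr' ?_
  filter_upwards [eventually_ne_atTop 0] with n hn
  have hn' : (n : ℝ) ≠ 0 := by exact_mod_cast hn
  rw [hS n hn, star_smul, smul_mul_assoc, mul_smul_comm, map_smul, map_smul, smul_eq_mul,
    smul_eq_mul, Complex.star_def, Complex.conj_natCast, ← Complex.ofReal_natCast,
    Complex.re_ofReal_mul, Complex.re_ofReal_mul]
  field_simp

theorem mem_extremePoints_of_tendsto_timeAvg {φ : A →L[ℂ] ℂ} (hφ : φ ∈ invariantStates γ)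
    (h : ∀ b, Tendsto (fun n => φ (star b * timeAvg γ n b)) atTop (𝓝 (φ (star b) * φ b))) :
    φ ∈ Set.extremePoints ℝ (invariantStates γ) := by
  have key : ∀ ψ ∈ invariantStates γ, ∀ t : ℝ, 0 < t →
      (∀ a, t * (ψ (star a * a)).re ≤ (φ (star a * a)).re) → ψ = φ := by
    intro ψ hψ t ht hle
    ext b
    obtain ⟨hpos, hone, hinv⟩ := hφ
    obtain ⟨hpos', hone', hinv'⟩ := hψ
    have h1 : ∀ n : ℕ, n ≠ 0 → t * ‖ψ b - φ b‖ ^ 2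
        ≤ (φ (star (timeAvg γ n b) * timeAvg γ n b)).re - ‖φ b‖ ^ 2 := fun n hn => by
      have h2 := norm_sq_le_of_nonneg hpos' hone' (timeAvg γ n b - φ b • 1)
      rw [map_sub, map_timeAvg hinv' hn, map_smul, hone', smul_eq_mul, mul_one] at h2
      refine ((mul_le_mul_of_nonneg_left h2 ht.le).trans (hle _)).trans (le_of_eq ?_)
      rw [← Complex.normSq_eq_norm_sq, Complex.normSq_apply]
      simp only [star_sub, star_smul, star_one, mul_sub, sub_mul, smul_mul_assoc, mul_smul_comm,
        one_mul, mul_one, map_sub, map_smul, hone, map_star_of_nonneg hpos, smul_eq_mul,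
        map_timeAvg hinv hn, Complex.star_def, Complex.sub_re, Complex.mul_re, Complex.conj_re,
        Complex.conj_im]
      ring
    have h3 := (tendsto_timeAvg_star_mul_self ⟨hpos, hone, hinv⟩ b (h b)).sub_const (‖φ b‖ ^ 2)
    rw [sub_self] at h3
    have h4 : t * ‖ψ b - φ b‖ ^ 2 ≤ 0 := by
      refine ge_of_tendsto h3 ?_
      filter_upwards [eventually_ne_atTop 0] with n hn using h1 n hn
    have h5 : ‖ψ b - φ b‖ ^ 2 ≤ 0 := by
      by_contra hc
      exact absurd h4 (not_le.mpr (mul_pos ht (not_le.mp hc)))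
    have h6 : ‖ψ b - φ b‖ = 0 := by nlinarith [norm_nonneg (ψ b - φ b)]
    exact sub_eq_zero.mp (norm_eq_zero.mp h6)
  refine mem_extremePoints.mpr ⟨hφ, ?_⟩
  rintro ψ hψ χ hχ ⟨s, t, hs, ht, -, hst⟩
  have hval : ∀ a, (φ (star a * a)).re = s * (ψ (star a * a)).re + t * (χ (star a * a)).re :=
    fun a => by
      rw [← hst]
      simp
  have hn : ∀ η ∈ invariantStates γ, ∀ a, 0 ≤ (η (star a * a)).re := fun η hη a =>
    (Complex.nonneg_iff.mp (hη.1 a)).1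
  refine ⟨key ψ hψ s hs fun a => ?_, key χ hχ t ht fun a => ?_⟩
  · rw [hval]
    have := mul_nonneg ht.le (hn χ hχ a)
    linarith
  · rw [hval]
    have := mul_nonneg hs.le (hn ψ hψ a)
    linarith

/-- Extremality passes to `φ ∘ S` if `S` preserves correlations asymptotically. -/
theorem comp_mem_extremePoints {B : Type*} [CStarAlgebra B] {δ : B →⋆ₐ[ℂ] B}
    (hcomm : ∀ a b : A, Tendsto (fun n => a * γ^[n] b - γ^[n] b * a) atTop (𝓝 0))
    {φ : A →L[ℂ] ℂ} {S : B →L[ℂ] A} (hφ : φ ∈ Set.extremePoints ℝ (invariantStates γ))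
    (hφS : φ.comp S ∈ invariantStates δ)
    (hcorr : ∀ a b, Tendsto (fun n => φ.comp S (a * δ^[n] b) - φ (S a * γ^[n] (S b))) atTop
      (𝓝 0)) :
    φ.comp S ∈ Set.extremePoints ℝ (invariantStates δ) := by
  refine mem_extremePoints_of_tendsto_timeAvg hφS fun b => ?_
  have h1 := (tendsto_cesaro_zero (hcorr (star b) b)).add
    (tendsto_timeAvg_of_extreme hcomm hφ (S (star b)) (S b))
  rw [zero_add] at h1
  refine h1.congr fun n => ?_
  simp only [timeAvg, mul_smul_comm, map_smul, Finset.mul_sum, map_sum, ← smul_add,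
    ← Finset.sum_add_distrib, sub_add_cancel]

end Abstract

section ProductElements

variable {d : ℕ}

/-! ### Product observables -/

instance : CStarAlgebra (QuasiLocal d) :=
  StarSubalgebra.cstarAlgebra (quasiLocal d)
    (h_closed := StarSubalgebra.isClosed_topologicalClosure _)

theorem incl_ampliate {Λ Λ' : Finset ℤ} (h : Λ ⊆ Λ') (a : LocalAlg d Λ) :
    incl Λ' (ampliate h a) = incl Λ a :=
  Subtype.ext (localHom_ampliate h a)

/-- The elementary tensor `⨂ a_i`. -/
def prodMat {ι : Type*} [Fintype ι] {m n : ℕ} (a : ι → Matrix (Fin m) (Fin n) ℂ) :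
    Matrix (ι → Fin m) (ι → Fin n) ℂ :=
  Matrix.of fun x y => ∏ i, a i (x i) (y i)

theorem prodMat_mul {ι : Type*} [Fintype ι] [DecidableEq ι] {l m n : ℕ}
    (a : ι → Matrix (Fin l) (Fin m) ℂ) (b : ι → Matrix (Fin m) (Fin n) ℂ) :
    prodMat a * prodMat b = prodMat fun i => a i * b i := by
  ext x y
  simp only [prodMat, Matrix.mul_apply, Matrix.of_apply, Fintype.prod_sum,
    ← Finset.prod_mul_distrib]

theorem prodMat_conjTranspose {ι : Type*} [Fintype ι] {m n : ℕ}
    (a : ι → Matrix (Fin m) (Fin n) ℂ) : (prodMat a)ᴴ = prodMat fun i => (a i)ᴴ := by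
  ext x y
  simp [prodMat, Matrix.conjTranspose_apply, star_prod]

theorem prodMat_one {ι : Type*} [Fintype ι] [DecidableEq ι] :
    prodMat (fun _ : ι => (1 : Matrix (Fin d) (Fin d) ℂ)) = 1 := by
  ext x y
  simp only [prodMat, Matrix.of_apply]
  by_cases h : x = y
  · subst h; simp
  · rw [Matrix.one_apply_ne h]
    obtain ⟨i, hi⟩ := Function.ne_iff.mp h
    exact Finset.prod_eq_zero (Finset.mem_univ i) (Matrix.one_apply_ne hi)

theorem sum_prodMat {ι κ : Type*} [Fintype ι] [DecidableEq ι] [Fintype κ] {m n : ℕ}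
    (f : ι → κ → Matrix (Fin m) (Fin n) ℂ) :
    ∑ k : ι → κ, prodMat (fun i => f i (k i)) = prodMat fun i => ∑ j, f i j := by
  ext x y
  simp only [prodMat, Matrix.sum_apply, Matrix.of_apply, Fintype.prod_sum]

theorem single_eq_prodMat {ι : Type*} [Fintype ι] [DecidableEq ι] (x y : ι → Fin d) :
    Matrix.single x y (1 : ℂ) = prodMat fun i => Matrix.single (x i) (y i) 1 := by
  ext x' y'
  simp only [prodMat, Matrix.of_apply, Matrix.single_apply]
  by_cases h : x = x' ∧ y = y'
  · obtain ⟨rfl, rfl⟩ := h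
    simp
  · rw [if_neg h]
    symm
    rw [not_and_or, ← Ne, ← Ne, Function.ne_iff, Function.ne_iff] at h
    obtain ⟨i, hi⟩ | ⟨i, hi⟩ := h
    · exact Finset.prod_eq_zero (Finset.mem_univ i) (if_neg fun h => hi h.1)
    · exact Finset.prod_eq_zero (Finset.mem_univ i) (if_neg fun h => hi h.2)

/-- Elementary tensors span. -/
theorem prodMat_induction {ι : Type*} [Fintype ι] [DecidableEq ι]
    {p : Matrix (ι → Fin d) (ι → Fin d) ℂ → Prop} (h0 : p 0)
    (hadd : ∀ a b, p a → p b → p (a + b)) (hsmul : ∀ (c : ℂ) a, p a → p (c • a))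
    (hprod : ∀ a : ι → Matrix (Fin d) (Fin d) ℂ, p (prodMat a)) (a) : p a := by
  rw [Matrix.matrix_eq_sum_single a]
  have hsum : ∀ (s : Finset (ι → Fin d)) (f : (ι → Fin d) → Matrix (ι → Fin d) (ι → Fin d) ℂ),
      (∀ i, p (f i)) → p (∑ i ∈ s, f i) := fun s f hf =>
    Finset.sum_induction f p hadd h0 fun i _ => hf i
  refine hsum _ _ fun x => hsum _ _ fun y => ?_
  have : Matrix.single x y (a x y) = a x y • Matrix.single x y (1 : ℂ) := by
    simp [Matrix.smul_single]
  rw [this, single_eq_prodMat]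
  exact hsmul _ _ (hprod _)

theorem ampliate_prodMat {Λ Λ' : Finset ℤ} (h : Λ ⊆ Λ') {a : ℤ → Matrix (Fin d) (Fin d) ℂ}
    (ha : ∀ i, i ∉ Λ → a i = 1) :
    ampliate h (prodMat fun i : Λ => a i) = prodMat fun i : Λ' => a i := by
  classical
  ext x y
  simp only [ampliate, prodMat, Matrix.of_apply]
  split_ifs with hxy
  · have h1 : ∏ i : Λ', a i (x i) (y i)
        = ∏ i : Λ', if hi : i.1 ∈ Λ then a i (x ⟨i, h hi⟩) (y ⟨i, h hi⟩) else 1 := by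
      refine Finset.prod_congr rfl fun i _ => ?_
      split_ifs with hi
      · rfl
      · rw [ha _ hi, hxy i hi, Matrix.one_apply_eq]
    rw [h1]
    let g : Λ → Λ' := fun i => ⟨i, h i.2⟩
    have hg : Function.Injective g := fun i j hij => Subtype.ext (congrArg (fun k : Λ' => k.1) hij)
    rw [← Finset.prod_subset (Finset.subset_univ (Finset.univ.image g)),
      Finset.prod_image hg.injOn]
    · refine Finset.prod_congr rfl fun i _ => ?_
      rw [dif_pos i.2]
    · intro i _ hi
      refine dif_neg fun hi' => hi ?_
      exact Finset.mem_image.mpr ⟨⟨i, hi'⟩, Finset.mem_univ _, rfl⟩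
  · push Not at hxy
    obtain ⟨i, hi, hne⟩ := hxy
    refine (Finset.prod_eq_zero (Finset.mem_univ i) ?_).symm
    rw [ha _ hi, Matrix.one_apply_ne hne]

/-- The product observable `⨂_{i ∈ Λ} a_i`. -/
def prodElem (Λ : Finset ℤ) (a : ℤ → Matrix (Fin d) (Fin d) ℂ) : QuasiLocal d :=
  incl Λ (prodMat fun i : Λ => a i)

theorem prodElem_congr {Λ : Finset ℤ} {a b : ℤ → Matrix (Fin d) (Fin d) ℂ}
    (h : ∀ i ∈ Λ, a i = b i) : prodElem Λ a = prodElem Λ b := by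
  have : (fun i : Λ => a i) = fun i : Λ => b i := funext fun i => h i i.2
  rw [prodElem, this, prodElem]

theorem prodElem_mono {Λ Λ' : Finset ℤ} (h : Λ ⊆ Λ') {a : ℤ → Matrix (Fin d) (Fin d) ℂ}
    (ha : ∀ i, i ∉ Λ → a i = 1) : prodElem Λ' a = prodElem Λ a := by
  rw [prodElem, ← ampliate_prodMat h ha, incl_ampliate, prodElem]

theorem prodElem_mul (Λ : Finset ℤ) (a b : ℤ → Matrix (Fin d) (Fin d) ℂ) :
    prodElem Λ a * prodElem Λ b = prodElem Λ fun i => a i * b i := by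
  rw [prodElem, prodElem, ← map_mul, prodMat_mul, prodElem]

theorem shift_prodElem (Λ : Finset ℤ) (a : ℤ → Matrix (Fin d) (Fin d) ℂ) :
    shift d (prodElem Λ a) = prodElem (shiftRegion Λ) fun i => a (i - 1) := by
  rw [prodElem, shift_incl, prodElem]
  congr 1
  ext x y
  simp only [prodMat, Matrix.of_apply]
  rw [← (siteEquiv Λ).prod_comp]
  refine Finset.prod_congr rfl fun i _ => ?_
  have : (((siteEquiv Λ i : shiftRegion Λ) : ℤ)) - 1 = i := by simp [siteEquiv]
  rw [this]
  rfl

/-- The translate `Λ + n`. -/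
def translate (n : ℕ) (Λ : Finset ℤ) : Finset ℤ := shiftRegion^[n] Λ

theorem mem_translate {n : ℕ} {Λ : Finset ℤ} {x : ℤ} : x ∈ translate n Λ ↔ x - n ∈ Λ := by
  induction n generalizing x with
  | zero => simp [translate]
  | succ n ih =>
    rw [translate, Function.iterate_succ_apply', mem_shiftRegion, ← translate, ih]
    have : x - 1 - (n : ℤ) = x - ((n + 1 : ℕ) : ℤ) := by push_cast; ring
    rw [this]

theorem iterate_shift_prodElem (n : ℕ) (Λ : Finset ℤ) (a : ℤ → Matrix (Fin d) (Fin d) ℂ) :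
    (shift d)^[n] (prodElem Λ a) = prodElem (translate n Λ) fun i => a (i - n) := by
  induction n with
  | zero => simp [translate]
  | succ n ih =>
    rw [Function.iterate_succ_apply', ih, shift_prodElem, translate, translate,
      Function.iterate_succ_apply']
    refine prodElem_congr fun i _ => ?_
    congr 1
    push_cast
    ring

theorem eventually_disjoint_translate (Λ Λ' : Finset ℤ) :
    ∀ᶠ n : ℕ in atTop, Disjoint Λ (translate n Λ') := by
  obtain ⟨M, hM⟩ := Λ.bddAbove
  obtain ⟨m, hm⟩ := Λ'.bddBelow
  filter_upwards [eventually_gt_atTop (M - m).toNat] with n hn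
  refine Finset.disjoint_left.mpr fun x hx hx' => ?_
  have h1 := hM hx
  have h2 := hm (mem_translate.mp hx')
  omega

/-! ### Density of local observables -/

theorem incl_induction {p : QuasiLocal d → Prop} (hp : IsClosed {x | p x})
    (h : ∀ Λ (a : LocalAlg d Λ), p (incl Λ a)) (x : QuasiLocal d) : p x := by
  have hdir : Directed (· ≤ ·) fun Λ : Finset ℤ => (localHom (d := d) Λ).range := by
    refine fun Λ Λ' => ⟨Λ ∪ Λ', ?_, ?_⟩
    · rintro _ ⟨a, rfl⟩
      exact ⟨ampliate Finset.subset_union_left a, localHom_ampliate _ a⟩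
    · rintro _ ⟨a, rfl⟩
      exact ⟨ampliate Finset.subset_union_right a, localHom_ampliate _ a⟩
  have hx : x.1 ∈ closure (⋃ Λ : Finset ℤ, ((localHom (d := d) Λ).range : Set _)) := by
    have h1 : x.1 ∈ ((⨆ Λ : Finset ℤ, (localHom (d := d) Λ).range).topologicalClosure : Set _) :=
      x.2
    rwa [StarSubalgebra.topologicalClosure_coe,
      StarSubalgebra.coe_iSup_of_directed hdir] at h1
  refine hp.closure_subset_iff.mpr (fun y hy => hy) ?_
  rw [Metric.mem_closure_iff]
  intro ε hε
  obtain ⟨y, hy, hxy⟩ := Metric.mem_closure_iff.mp hx ε hε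
  obtain ⟨Λ, a, rfl⟩ := Set.mem_iUnion.mp hy
  exact ⟨incl Λ a, h Λ a, hxy⟩

/-- A closed property of observables that is stable under linear combinations holds everywhere if
it holds for product observables. -/
theorem prodElem_induction {p : QuasiLocal d → Prop} (hp : IsClosed {x | p x}) (h0 : p 0)
    (hadd : ∀ a b, p a → p b → p (a + b)) (hsmul : ∀ (c : ℂ) a, p a → p (c • a))
    (hprod : ∀ (Λ : Finset ℤ) (a : ℤ → Matrix (Fin d) (Fin d) ℂ), (∀ i, i ∉ Λ → a i = 1) →
      p (prodElem Λ a)) (x : QuasiLocal d) : p x := by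
  classical
  refine incl_induction hp (fun Λ a => ?_) x
  refine prodMat_induction (p := fun a => p (incl Λ a)) ?_ ?_ ?_ ?_ a
  · rwa [map_zero]
  · intro a b ha hb
    rw [map_add]
    exact hadd _ _ ha hb
  · intro c a ha
    rw [map_smul]
    exact hsmul _ _ ha
  · intro a
    have h := hprod Λ (fun i => if h : i ∈ Λ then a ⟨i, h⟩ else 1) (fun i hi => dif_neg hi)
    simpa [prodElem] using h

/-! ### Asymptotic factorization of bilinear expressions -/

/-- Equicontinuous sequences of linear maps: convergence to `0` is a closed linear condition. -/
theorem isClosed_setOf_tendsto_zero {E F : Type*} [SeminormedAddCommGroup E]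
    [SeminormedAddCommGroup F] (u : ℕ → E → F) (C : ℝ)
    (hu : ∀ n x y, ‖u n x - u n y‖ ≤ C * ‖x - y‖) :
    IsClosed {x | Tendsto (fun n => u n x) atTop (𝓝 0)} := by
  rw [← isSeqClosed_iff_isClosed]
  intro x y hx hxy
  simp only [Set.mem_ofPred_eq] at hx ⊢
  rw [Metric.tendsto_atTop]
  intro ε hε
  have hC : Tendsto (fun k => C * ‖y - x k‖) atTop (𝓝 0) := by
    have h1 := (tendsto_const_nhds (x := y)).sub hxy
    rw [sub_self] at h1
    simpa using h1.norm.const_mul C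
  obtain ⟨k, hk⟩ := (hC.eventually_lt_const (half_pos hε)).exists
  obtain ⟨N, hN⟩ := Metric.tendsto_atTop.mp (hx k) (ε / 2) (half_pos hε)
  refine ⟨N, fun n hn => ?_⟩
  have h1 := hN n hn
  rw [dist_zero_right] at h1 ⊢
  calc ‖u n y‖ = ‖(u n y - u n (x k)) + u n (x k)‖ := by rw [sub_add_cancel]
    _ ≤ ‖u n y - u n (x k)‖ + ‖u n (x k)‖ := norm_add_le _ _
    _ < ε := by linarith [hu n y (x k)]

/-- A uniformly bounded sequence of bilinear maps that vanishes asymptotically on pairs of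
product observables vanishes asymptotically everywhere. -/
theorem tendsto_zero_of_prodElem {F : Type*} [NormedAddCommGroup F] [NormedSpace ℂ F]
    (B : ℕ → QuasiLocal d →ₗ[ℂ] QuasiLocal d →ₗ[ℂ] F) (C : ℝ)
    (hB : ∀ n a b, ‖B n a b‖ ≤ C * ‖a‖ * ‖b‖)
    (h : ∀ (Λ Λ' : Finset ℤ) (a b : ℤ → Matrix (Fin d) (Fin d) ℂ), (∀ i, i ∉ Λ → a i = 1) →
      (∀ i, i ∉ Λ' → b i = 1) →
      ∀ᶠ n in atTop, B n (prodElem Λ a) (prodElem Λ' b) = 0) (a b : QuasiLocal d) :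
    Tendsto (fun n => B n a b) atTop (𝓝 0) := by
  refine prodElem_induction (p := fun a => Tendsto (fun n => B n a b) atTop (𝓝 0)) ?_ ?_ ?_ ?_ ?_ a
  · refine isClosed_setOf_tendsto_zero (fun n a => B n a b) (C * ‖b‖) fun n x y => ?_
    rw [← LinearMap.sub_apply, ← map_sub]
    exact (hB n _ _).trans (le_of_eq (by ring))
  · simp
  · intro a a' ha ha'
    simpa using ha.add ha'
  · intro c a ha
    simpa using ha.const_smul c
  · intro Λ a ha
    refine prodElem_induction
      (p := fun b => Tendsto (fun n => B n (prodElem Λ a) b) atTop (𝓝 0)) ?_ ?_ ?_ ?_ ?_ b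
    · refine isClosed_setOf_tendsto_zero (fun n b => B n (prodElem Λ a) b) (C * ‖prodElem Λ a‖)
        fun n x y => ?_
      rw [← map_sub]
      exact hB n _ _
    · simp
    · intro b b' hb hb'
      simpa using hb.add hb'
    · intro c b hb
      simpa using hb.const_smul c
    · intro Λ' b hb
      refine tendsto_const_nhds.congr' ?_
      filter_upwards [h Λ Λ' a b ha hb] with n hn using hn.symm

/-- The iterated shift as a linear map. -/
def shiftPow (d n : ℕ) : QuasiLocal d →ₗ[ℂ] QuasiLocal d where
  toFun := (shift d)^[n]
  map_add' := iterate_map_add _ n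
  map_smul' := iterate_map_complex_smul _ n

/-- The product of an observable at `Λ` and a distant translate. -/
theorem prodElem_mul_translate {Λ Λ' : Finset ℤ} {a b : ℤ → Matrix (Fin d) (Fin d) ℂ}
    (ha : ∀ i, i ∉ Λ → a i = 1) (hb : ∀ i, i ∉ Λ' → b i = 1) (n : ℕ) :
    prodElem Λ a * (shift d)^[n] (prodElem Λ' b)
        = prodElem (Λ ∪ translate n Λ') (fun i => a i * b (i - n)) ∧
      (shift d)^[n] (prodElem Λ' b) * prodElem Λ a
        = prodElem (Λ ∪ translate n Λ') fun i => b (i - n) * a i := by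
  have hb' : ∀ i, i ∉ translate n Λ' → b (i - n) = 1 := fun i hi =>
    hb _ fun h => hi (mem_translate.mpr h)
  rw [iterate_shift_prodElem, ← prodElem_mono Finset.subset_union_left ha,
    ← prodElem_mono (Finset.subset_union_right (s₁ := Λ)) hb', prodElem_mul, prodElem_mul]
  exact ⟨rfl, rfl⟩

theorem eq_one_or_eq_one {Λ Λ' : Finset ℤ} {a b : ℤ → Matrix (Fin d) (Fin d) ℂ}
    (ha : ∀ i, i ∉ Λ → a i = 1) (hb : ∀ i, i ∉ Λ' → b i = 1) {n : ℕ}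
    (h : Disjoint Λ (translate n Λ')) (i : ℤ) : a i = 1 ∨ b (i - n) = 1 := by
  by_cases hi : i ∈ Λ
  · exact Or.inr (hb _ fun h' => Finset.disjoint_left.mp h hi (mem_translate.mpr h'))
  · exact Or.inl (ha _ hi)

/-- The shift acts in an asymptotically abelian way. -/
theorem tendsto_shift_commutator (a b : QuasiLocal d) :
    Tendsto (fun n => a * (shift d)^[n] b - (shift d)^[n] b * a) atTop (𝓝 0) := by
  refine tendsto_zero_of_prodElem (fun n =>
    (LinearMap.mul ℂ (QuasiLocal d) - (LinearMap.mul ℂ (QuasiLocal d)).flip).compl₂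
      (shiftPow d n)) 2 (fun n a b => ?_) (fun Λ Λ' a b ha hb => ?_) a b
  · change ‖a * (shift d)^[n] b - (shift d)^[n] b * a‖ ≤ _
    refine (norm_sub_le _ _).trans ?_
    have h1 := norm_mul_le a ((shift d)^[n] b)
    have h2 := norm_mul_le ((shift d)^[n] b) a
    have h3 := mul_le_mul_of_nonneg_left (norm_iterate_le (shift d) n b) (norm_nonneg a)
    linarith
  · filter_upwards [eventually_disjoint_translate Λ Λ'] with n hn
    change prodElem Λ a * (shift d)^[n] (prodElem Λ' b)
      - (shift d)^[n] (prodElem Λ' b) * prodElem Λ a = 0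
    rw [(prodElem_mul_translate ha hb n).1, (prodElem_mul_translate ha hb n).2, sub_eq_zero]
    refine prodElem_congr fun i _ => ?_
    rcases eq_one_or_eq_one ha hb hn i with h | h <;> simp [h]

end ProductElements

section Kraus

variable {d d' : ℕ}

/-! ### Kraus form and tensor powers -/

theorem exists_eq_star_mul_self {B : Type*} [NonUnitalCStarAlgebra B] [PartialOrder B]
    [StarOrderedRing B] {a : B} (ha : 0 ≤ a) : ∃ b, a = star b * b :=
  CStarAlgebra.nonneg_iff_eq_star_mul_self.mp ha

open scoped CStarAlgebra MatrixOrder Matrix.Norms.L2Operator in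
/-- Kraus form of a completely positive map. -/
theorem Channel.exists_kraus [NeZero d] (E : Channel d d') :
    ∃ K : Fin d × Fin d' → Matrix (Fin d') (Fin d) ℂ,
      ∀ a, E.toLin a = ∑ k, K k * a * (K k)ᴴ := by
  let R : CStarMatrix (Fin d) (Fin d) (Matrix (Fin d) (Fin d) ℂ) :=
    CStarMatrix.ofMatrix (Matrix.of fun r q => if r = 0 then Matrix.single 0 q 1 else 0)
  have hR : ∀ p q, (star R * R) p q = Matrix.single p q 1 := fun p q => by
    rw [CStarMatrix.mul_apply, Finset.sum_eq_single 0]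
    · simp [CStarMatrix.star_apply, R, Matrix.star_eq_conjTranspose]
    · intro r _ hr
      simp [R, hr]
    · simp
  obtain ⟨N, hN⟩ := exists_eq_star_mul_self
    (E.map_cstarMatrix_nonneg' d (star R * R) (star_mul_self_nonneg R))
  have hE : ∀ p q, E.toLin (Matrix.single p q 1) = ∑ r, (N r p)ᴴ * N r q := fun p q => by
    have h := congrFun (congrFun hN p) q
    rw [CStarMatrix.map_apply, hR, CStarMatrix.mul_apply] at h
    exact h
  refine ⟨fun k => Matrix.of fun x p => star (N k.1 p k.2 x), fun a => ?_⟩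
  ext x y
  conv_lhs => rw [Matrix.matrix_eq_sum_single a]
  have h1 : ∀ p q, Matrix.single p q (a p q) = a p q • Matrix.single p q (1 : ℂ) := fun p q => by
    simp [Matrix.smul_single]
  simp only [h1, map_sum, map_smul, hE, Matrix.sum_apply, Matrix.smul_apply, Matrix.mul_apply,
    Matrix.conjTranspose_apply, Matrix.of_apply, star_star, Fintype.sum_prod_type, smul_eq_mul,
    Finset.mul_sum, Finset.sum_mul]
  rw [Finset.sum_comm]
  refine Eq.trans (Finset.sum_congr rfl fun q _ => Finset.sum_comm) ?_
  rw [Finset.sum_comm]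
  refine Finset.sum_congr rfl fun r _ => ?_
  refine Eq.trans (Finset.sum_congr rfl fun q _ => Finset.sum_comm) ?_
  rw [Finset.sum_comm]
  refine Finset.sum_congr rfl fun z _ => Finset.sum_congr rfl fun q _ =>
    Finset.sum_congr rfl fun p _ => ?_
  ring

theorem sum_kraus_eq_one (E : Channel d d') {κ : Type*} [Fintype κ]
    {K : κ → Matrix (Fin d') (Fin d) ℂ} (hK : ∀ a, E.toLin a = ∑ k, K k * a * (K k)ᴴ) :
    ∑ k, (K k)ᴴ * K k = 1 := by
  refine Matrix.ext_iff_trace_mul_right.mpr fun a => ?_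
  have h : (E.toLin a).trace = a.trace := E.trace_preserving a
  rw [hK, Matrix.trace_sum] at h
  rw [one_mul, ← h, Finset.sum_mul, Matrix.trace_sum]
  refine Finset.sum_congr rfl fun k _ => ?_
  rw [Matrix.mul_assoc, Matrix.trace_mul_comm, Matrix.mul_assoc]

variable {κ ι : Type*} [Fintype κ] [Fintype ι] [DecidableEq ι]

/-- `a ↦ ∑_k (⨂ K_{k_i})ᴴ a (⨂ K_{k_i})`: the tensor power of the unital completely positive map
with Kraus operators `(K k)ᴴ`. -/
def dualPower (ι : Type*) [Fintype ι] [DecidableEq ι] (K : κ → Matrix (Fin d') (Fin d) ℂ) :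
    Matrix (ι → Fin d') (ι → Fin d') ℂ →ₗ[ℂ] Matrix (ι → Fin d) (ι → Fin d) ℂ where
  toFun a := ∑ k : ι → κ, (prodMat fun i => K (k i))ᴴ * a * prodMat fun i => K (k i)
  map_add' a b := by simp only [Matrix.mul_add, Matrix.add_mul, Finset.sum_add_distrib]
  map_smul' c a := by
    simp only [Matrix.mul_smul, Matrix.smul_mul, Finset.smul_sum, RingHom.id_apply]

theorem dualPower_apply (K : κ → Matrix (Fin d') (Fin d) ℂ)
    (a : Matrix (ι → Fin d') (ι → Fin d') ℂ) :
    dualPower ι K a = ∑ k : ι → κ, (prodMat fun i => K (k i))ᴴ * a * prodMat fun i => K (k i) :=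
  rfl

theorem dualPower_prodMat (K : κ → Matrix (Fin d') (Fin d) ℂ)
    (a : ι → Matrix (Fin d') (Fin d') ℂ) :
    dualPower ι K (prodMat a) = prodMat fun i => ∑ k, (K k)ᴴ * a i * K k := by
  simp only [dualPower_apply, prodMat_conjTranspose, prodMat_mul]
  exact sum_prodMat fun i k => (K k)ᴴ * a i * K k

theorem dualPower_one {K : κ → Matrix (Fin d') (Fin d) ℂ} (hK : ∑ k, (K k)ᴴ * K k = 1) :
    dualPower ι K 1 = 1 := by
  rw [← prodMat_one, dualPower_prodMat]
  simp only [Matrix.mul_one, hK, prodMat_one]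

theorem tensorPower_eq_sum {E : Matrix (Fin d) (Fin d) ℂ →ₗ[ℂ] Matrix (Fin d') (Fin d') ℂ}
    {K : κ → Matrix (Fin d') (Fin d) ℂ} (hK : ∀ a, E a = ∑ k, K k * a * (K k)ᴴ)
    (ρ : Matrix (ι → Fin d) (ι → Fin d) ℂ) :
    tensorPower E ρ
      = ∑ k : ι → κ, (prodMat fun i => K (k i)) * ρ * (prodMat fun i => K (k i))ᴴ := by
  refine prodMat_induction (p := fun ρ => tensorPower E ρ
    = ∑ k : ι → κ, (prodMat fun i => K (k i)) * ρ * (prodMat fun i => K (k i))ᴴ) ?_ ?_ ?_ ?_ ρ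
  · ext x y
    simp [tensorPower]
  · intro a b ha hb
    simp only [Matrix.mul_add, Matrix.add_mul, Finset.sum_add_distrib, ← ha, ← hb]
    ext x y
    simp [tensorPower, add_mul, Finset.sum_add_distrib]
  · intro c a ha
    simp only [Matrix.mul_smul, Matrix.smul_mul, ← Finset.smul_sum, ← ha]
    ext x y
    simp [tensorPower, Finset.mul_sum, mul_assoc]
  · intro a
    have h1 : tensorPower E (prodMat a) = prodMat fun i => E (a i) := tensorPower_prod E a
    simp only [h1, hK, prodMat_conjTranspose, prodMat_mul]
    exact (sum_prodMat fun i k => K k * a i * (K k)ᴴ).symm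

theorem trace_tensorPower_mul {E : Matrix (Fin d) (Fin d) ℂ →ₗ[ℂ] Matrix (Fin d') (Fin d') ℂ}
    {K : κ → Matrix (Fin d') (Fin d) ℂ} (hK : ∀ a, E a = ∑ k, K k * a * (K k)ᴴ)
    (ρ : Matrix (ι → Fin d) (ι → Fin d) ℂ) (a : Matrix (ι → Fin d') (ι → Fin d') ℂ) :
    (tensorPower E ρ * a).trace = (ρ * dualPower ι K a).trace := by
  rw [tensorPower_eq_sum hK, dualPower_apply, Finset.sum_mul, Finset.mul_sum, Matrix.trace_sum,
    Matrix.trace_sum]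
  refine Finset.sum_congr rfl fun k _ => ?_
  rw [Matrix.mul_assoc, Matrix.mul_assoc, Matrix.trace_mul_comm, Matrix.mul_assoc,
    Matrix.mul_assoc]

theorem posSemidef_tensorPower
    {E : Matrix (Fin d) (Fin d) ℂ →ₗ[ℂ] Matrix (Fin d') (Fin d') ℂ}
    {K : κ → Matrix (Fin d') (Fin d) ℂ} (hK : ∀ a, E a = ∑ k, K k * a * (K k)ᴴ)
    {ρ : Matrix (ι → Fin d) (ι → Fin d) ℂ} (hρ : ρ.PosSemidef) : (tensorPower E ρ).PosSemidef := by
  rw [tensorPower_eq_sum hK]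
  exact Matrix.posSemidef_sum _ fun k _ => hρ.mul_mul_conjTranspose_same _

open scoped Matrix.Norms.L2Operator in
/-- Unital completely positive maps in Kraus form are contractive. -/
theorem norm_sum_kraus_le {m n : Type*} [Fintype m] [DecidableEq m] [Fintype n] [DecidableEq n]
    (W : κ → Matrix m n ℂ) (hW : ∑ k, (W k)ᴴ * W k = 1) (a : Matrix m m ℂ) :
    ‖∑ k, (W k)ᴴ * a * W k‖ ≤ ‖a‖ := by
  classical
  let V : Matrix (m × κ) n ℂ := Matrix.of fun x y => W x.2 x.1 y
  let Φ : Matrix m m ℂ →⋆ₙₐ[ℂ] Matrix (m × κ) (m × κ) ℂ :=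
    { toFun := fun a => Matrix.blockDiagonal fun _ => a
      map_smul' := fun c a => Matrix.blockDiagonal_smul c _
      map_zero' := Matrix.blockDiagonal_zero
      map_add' := fun a b => Matrix.blockDiagonal_add _ _
      map_mul' := fun a b => Matrix.blockDiagonal_mul _ _
      map_star' := fun a => (Matrix.blockDiagonal_conjTranspose _).symm }
  have hV : ∀ a, ∑ k, (W k)ᴴ * a * W k = Vᴴ * Φ a * V := fun a => by
    ext x y
    have : ∀ i j, Φ a i j = if i.2 = j.2 then a i.1 j.1 else 0 := fun i j =>
      Matrix.blockDiagonal_apply (fun _ => a) i j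
    simp only [Matrix.sum_apply, Matrix.mul_apply, Matrix.conjTranspose_apply, V, Matrix.of_apply,
      this, Fintype.sum_prod_type, mul_ite, mul_zero, Finset.sum_ite_eq', Finset.mem_univ, if_true]
    rw [Finset.sum_comm]
  have hV1 : Vᴴ * V = 1 := by
    rw [← hW]
    ext x y
    simp only [Matrix.sum_apply, Matrix.mul_apply, Matrix.conjTranspose_apply, V, Matrix.of_apply,
      Fintype.sum_prod_type]
    rw [Finset.sum_comm]
  have hVn : ‖V‖ ≤ 1 := by
    have h1 := Matrix.l2_opNorm_conjTranspose_mul_self V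
    rw [hV1] at h1
    have h2 : ‖(1 : Matrix n n ℂ)‖ ≤ 1 := by
      cases subsingleton_or_nontrivial (Matrix n n ℂ)
      · rw [Subsingleton.elim (1 : Matrix n n ℂ) 0, norm_zero]
        exact zero_le_one
      · exact (CStarRing.norm_one).le
    nlinarith [norm_nonneg V]
  have hVn' : ‖Vᴴ‖ ≤ 1 := by rwa [Matrix.l2_opNorm_conjTranspose]
  have hΦ : ‖Φ a‖ ≤ ‖a‖ := NonUnitalStarAlgHom.norm_apply_le Φ a
  rw [hV]
  calc ‖Vᴴ * Φ a * V‖ ≤ ‖Vᴴ * Φ a‖ * ‖V‖ := Matrix.l2_opNorm_mul _ _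
    _ ≤ ‖Vᴴ‖ * ‖Φ a‖ * ‖V‖ := by gcongr; exact Matrix.l2_opNorm_mul _ _
    _ ≤ 1 * ‖a‖ * 1 := by gcongr
    _ = ‖a‖ := by ring

end Kraus

section Extension

variable {d d' : ℕ}

/-! ### The dual channel on the quasilocal algebra -/

theorem ampliate_zero {Λ Λ' : Finset ℤ} (h : Λ ⊆ Λ') :
    ampliate h (0 : LocalAlg d Λ) = 0 := by
  ext x y
  simp [ampliate]

theorem ampliate_add {Λ Λ' : Finset ℤ} (h : Λ ⊆ Λ') (a b : LocalAlg d Λ) :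
    ampliate h (a + b) = ampliate h a + ampliate h b := by
  ext x y
  simp only [ampliate, Matrix.of_apply, Matrix.add_apply]
  split_ifs <;> simp

theorem ampliate_smul {Λ Λ' : Finset ℤ} (h : Λ ⊆ Λ') (c : ℂ) (a : LocalAlg d Λ) :
    ampliate h (c • a) = c • ampliate h a := by
  ext x y
  simp only [ampliate, Matrix.of_apply, Matrix.smul_apply]
  split_ifs <;> simp

open scoped Matrix.Norms.L2Operator in
theorem norm_incl [NeZero d] (Λ : Finset ℤ) (a : LocalAlg d Λ) : ‖incl Λ a‖ = ‖a‖ :=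
  NonUnitalStarAlgHom.norm_map (localHom (d := d) Λ) (localHom_injective Λ) a

/-- A compatible bounded family of linear maps of local algebras extends to the quasilocal
algebras. -/
theorem exists_extension (T : ∀ Λ : Finset ℤ, LocalAlg d' Λ →ₗ[ℂ] LocalAlg d Λ)
    (hT : ∀ {Λ Λ' : Finset ℤ} (h : Λ ⊆ Λ') (a : LocalAlg d' Λ),
      T Λ' (ampliate h a) = ampliate h (T Λ a))
    (hbound : ∀ Λ a, ‖incl Λ (T Λ a)‖ ≤ ‖incl Λ a‖) :
    ∃ S : QuasiLocal d' →L[ℂ] QuasiLocal d, ∀ Λ a, S (incl Λ a) = incl Λ (T Λ a) := by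
  classical
  let e : (DirectSum (Finset ℤ) fun Λ => LocalAlg d' Λ) →ₗ[ℂ] QuasiLocal d' :=
    DirectSum.toModule ℂ (Finset ℤ) (QuasiLocal d') fun Λ => (incl Λ).toAlgHom.toLinearMap
  let f : (DirectSum (Finset ℤ) fun Λ => LocalAlg d' Λ) →ₗ[ℂ] QuasiLocal d :=
    DirectSum.toModule ℂ (Finset ℤ) (QuasiLocal d) fun Λ =>
      (incl Λ).toAlgHom.toLinearMap ∘ₗ T Λ
  have he : ∀ Λ a, e (DirectSum.lof ℂ _ _ Λ a) = incl Λ a := fun Λ a =>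
    DirectSum.toModule_lof ℂ Λ a
  have hf : ∀ Λ a, f (DirectSum.lof ℂ _ _ Λ a) = incl Λ (T Λ a) := fun Λ a =>
    DirectSum.toModule_lof ℂ Λ a
  have hloc : ∀ v, ∃ Λ a, e v = incl Λ a ∧ f v = incl Λ (T Λ a) := by
    intro v
    induction v using DirectSum.induction_on with
    | zero => exact ⟨∅, 0, by simp, by simp⟩
    | of Λ a => exact ⟨Λ, a, he Λ a, hf Λ a⟩
    | add v w hv hw =>
      obtain ⟨Λ, a, h1, h2⟩ := hv
      obtain ⟨Λ', a', h1', h2'⟩ := hw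
      refine ⟨Λ ∪ Λ', ampliate Finset.subset_union_left a
        + ampliate Finset.subset_union_right a', ?_, ?_⟩
      · rw [map_add, h1, h1', map_add, incl_ampliate, incl_ampliate]
      · rw [map_add, h2, h2', map_add, map_add, hT, hT, incl_ampliate, incl_ampliate]
  have hnorm : ∃ C, ∀ v, ‖f v‖ ≤ C * ‖e v‖ := ⟨1, fun v => by
    obtain ⟨Λ, a, h1, h2⟩ := hloc v
    rw [h1, h2, one_mul]
    exact hbound Λ a⟩
  have hdense : DenseRange e := fun x =>
    incl_induction (p := fun x => x ∈ closure (Set.range e)) isClosed_closure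
      (fun Λ a => subset_closure ⟨_, he Λ a⟩) x
  refine ⟨f.extendOfNorm e, fun Λ a => ?_⟩
  rw [← he, LinearMap.extendOfNorm_eq hdense hnorm, hf]

variable {κ : Type*} [Fintype κ] {K : κ → Matrix (Fin d') (Fin d) ℂ}

theorem dualPower_ampliate (hK : ∑ k, (K k)ᴴ * K k = 1) {Λ Λ' : Finset ℤ} (h : Λ ⊆ Λ')
    (a : LocalAlg d' Λ) : dualPower Λ' K (ampliate h a) = ampliate h (dualPower Λ K a) := by
  refine prodMat_induction
    (p := fun a => dualPower Λ' K (ampliate h a) = ampliate h (dualPower Λ K a)) ?_ ?_ ?_ ?_ a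
  · rw [ampliate_zero, map_zero, map_zero, ampliate_zero]
  · intro a b ha hb
    rw [ampliate_add, map_add, ha, hb, map_add, ampliate_add]
  · intro c a ha
    rw [ampliate_smul, map_smul, ha, map_smul, ampliate_smul]
  · intro a
    let b : ℤ → Matrix (Fin d') (Fin d') ℂ := fun i => if hi : i ∈ Λ then a ⟨i, hi⟩ else 1
    have hab : a = fun i : Λ => b i := funext fun i => by simp [b]
    have hb : ∀ i, i ∉ Λ → b i = 1 := fun i hi => dif_neg hi
    rw [hab, ampliate_prodMat h hb, dualPower_prodMat, dualPower_prodMat,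
      ampliate_prodMat h (a := fun i => ∑ k, (K k)ᴴ * b i * K k)]
    intro i hi
    simp only [hb i hi, Matrix.mul_one, hK]

/-- The Heisenberg picture of the memoryless channel, on the quasilocal algebra. -/
theorem exists_dualMap [NeZero d] [NeZero d'] (hK : ∑ k, (K k)ᴴ * K k = 1) :
    ∃ S : QuasiLocal d' →L[ℂ] QuasiLocal d, ∀ Λ a, S (incl Λ a) = incl Λ (dualPower Λ K a) := by
  refine exists_extension (fun Λ => dualPower Λ K) (fun h a => dualPower_ampliate hK h a)
    fun Λ a => ?_
  rw [norm_incl, norm_incl]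
  refine norm_sum_kraus_le (fun k : Λ → κ => prodMat fun i => K (k i)) ?_ a
  simpa [dualPower_apply] using dualPower_one (ι := Λ) hK

variable {S : QuasiLocal d' →L[ℂ] QuasiLocal d}

theorem dualMap_one (hK : ∑ k, (K k)ᴴ * K k = 1)
    (hS : ∀ Λ a, S (incl Λ a) = incl Λ (dualPower Λ K a)) : S 1 = 1 := by
  have h := hS ∅ 1
  rwa [dualPower_one hK, map_one (incl (d := d') ∅), map_one (incl (d := d) ∅)] at h

theorem dualMap_prodElem (hS : ∀ Λ a, S (incl Λ a) = incl Λ (dualPower Λ K a)) (Λ : Finset ℤ)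
    (a : ℤ → Matrix (Fin d') (Fin d') ℂ) :
    S (prodElem Λ a) = prodElem Λ fun i => ∑ k, (K k)ᴴ * a i * K k := by
  rw [prodElem, hS, dualPower_prodMat, prodElem]

theorem dualMap_shift (hS : ∀ Λ a, S (incl Λ a) = incl Λ (dualPower Λ K a)) (a : QuasiLocal d') :
    S (shift d' a) = shift d (S a) := by
  have hc : ∀ n, Continuous (shift n) := fun n => AddMonoidHomClass.continuous_of_bound
    (shift n) 1 fun x => by rw [one_mul]; exact norm_iterate_le (shift n) 1 x
  refine prodElem_induction (p := fun a => S (shift d' a) = shift d (S a)) ?_ ?_ ?_ ?_ ?_ a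
  · exact isClosed_eq (S.continuous.comp (hc d')) ((hc d).comp S.continuous)
  · simp only [map_zero]
  · intro a b ha hb
    simp only [map_add, ha, hb]
  · intro c a ha
    simp only [map_smul, ha]
  · intro Λ a _
    rw [shift_prodElem, dualMap_prodElem hS, dualMap_prodElem hS, shift_prodElem]

theorem isClosed_setOf_nonneg {A : Type*} [CStarAlgebra A] (φ : A →L[ℂ] ℂ) :
    IsClosed {a | 0 ≤ φ (star a * a)} :=
  isClosed_le continuous_const (φ.continuous.comp (continuous_star.mul continuous_id))

open scoped MatrixOrder Matrix.Norms.L2Operator in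
theorem exists_eq_conjTranspose_mul_self {n : Type*} [Fintype n] [DecidableEq n]
    {a : Matrix n n ℂ} (ha : a.PosSemidef) : ∃ c, a = cᴴ * c :=
  exists_eq_star_mul_self ha.nonneg

theorem dualMap_nonneg (hS : ∀ Λ a, S (incl Λ a) = incl Λ (dualPower Λ K a))
    {φ : QuasiLocal d →L[ℂ] ℂ} (hφ : ∀ a, 0 ≤ φ (star a * a)) (a : QuasiLocal d') :
    0 ≤ φ (S (star a * a)) := by
  refine incl_induction (p := fun a => 0 ≤ φ (S (star a * a)))
    (isClosed_setOf_nonneg (φ.comp S)) (fun Λ a => ?_) a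
  have hpos : (dualPower Λ K (star a * a)).PosSemidef := by
    rw [dualPower_apply]
    refine Matrix.posSemidef_sum _ fun k _ => ?_
    exact (Matrix.posSemidef_conjTranspose_mul_self a).conjTranspose_mul_mul_same _
  obtain ⟨c, hc⟩ := exists_eq_conjTranspose_mul_self hpos
  rw [← map_star, ← map_mul, hS, hc, ← Matrix.star_eq_conjTranspose, map_mul, map_star]
  exact hφ _

/-- The dual map factorizes asymptotically. -/
theorem tendsto_dualMap_mul (hK : ∑ k, (K k)ᴴ * K k = 1)
    (hS : ∀ Λ a, S (incl Λ a) = incl Λ (dualPower Λ K a)) (a b : QuasiLocal d') :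
    Tendsto (fun n => S (a * (shift d')^[n] b) - S a * (shift d)^[n] (S b)) atTop (𝓝 0) := by
  refine tendsto_zero_of_prodElem (fun n =>
    ((LinearMap.mul ℂ (QuasiLocal d')).compr₂ S.toLinearMap).compl₂ (shiftPow d' n)
      - (LinearMap.mul ℂ (QuasiLocal d)).compl₁₂ S.toLinearMap (shiftPow d n ∘ₗ S.toLinearMap))
    (‖S‖ + ‖S‖ * ‖S‖) (fun n a b => ?_) (fun Λ Λ' a b ha hb => ?_) a b
  · change ‖S (a * (shift d')^[n] b) - S a * (shift d)^[n] (S b)‖ ≤ _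
    have h1 : ‖S (a * (shift d')^[n] b)‖ ≤ ‖S‖ * (‖a‖ * ‖b‖) := by
      refine (S.le_opNorm _).trans ?_
      gcongr
      refine (norm_mul_le _ _).trans ?_
      gcongr
      exact norm_iterate_le _ _ _
    have h2 : ‖S a * (shift d)^[n] (S b)‖ ≤ (‖S‖ * ‖a‖) * (‖S‖ * ‖b‖) := by
      refine (norm_mul_le _ _).trans ?_
      gcongr
      · exact S.le_opNorm a
      · exact (norm_iterate_le _ _ _).trans (S.le_opNorm b)
    refine (norm_sub_le _ _).trans ((add_le_add h1 h2).trans (le_of_eq ?_))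
    ring
  · filter_upwards [eventually_disjoint_translate Λ Λ'] with n hn
    change S (prodElem Λ a * (shift d')^[n] (prodElem Λ' b))
      - S (prodElem Λ a) * (shift d)^[n] (S (prodElem Λ' b)) = 0
    rw [(prodElem_mul_translate ha hb n).1, dualMap_prodElem hS, dualMap_prodElem hS,
      dualMap_prodElem hS, (prodElem_mul_translate (a := fun i => ∑ k, (K k)ᴴ * a i * K k)
        (b := fun i => ∑ k, (K k)ᴴ * b i * K k) ?_ ?_ n).1, sub_eq_zero]
    · refine prodElem_congr fun i _ => ?_
      rcases eq_one_or_eq_one ha hb hn i with h | h <;> simp [h, hK]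
    · intro i hi
      simp only [ha i hi, Matrix.mul_one, hK]
    · intro i hi
      simp only [hb i hi, Matrix.mul_one, hK]

/-! ### Transfer of ergodic properties -/

theorem invariantStates_shift :
    invariantStates (shift d) = {ψ : QuasiLocal d →L[ℂ] ℂ | IsStationaryState ψ} := by
  ext ψ
  exact ⟨fun h => ⟨⟨h.1, h.2.1⟩, h.2.2⟩, fun h => ⟨h.isState.nonneg, h.isState.map_one,
    h.shift_invariant⟩⟩

variable {φ : QuasiLocal d →L[ℂ] ℂ}

theorem IsStationaryState.comp_dualMap (hK : ∑ k, (K k)ᴴ * K k = 1)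
    (hS : ∀ Λ a, S (incl Λ a) = incl Λ (dualPower Λ K a)) (hφ : IsStationaryState φ) :
    IsStationaryState (φ.comp S) where
  isState :=
    { nonneg := dualMap_nonneg hS hφ.isState.nonneg
      map_one := by
        rw [ContinuousLinearMap.comp_apply, dualMap_one hK hS, hφ.isState.map_one] }
  shift_invariant a := by
    rw [ContinuousLinearMap.comp_apply, dualMap_shift hS, hφ.shift_invariant]
    rfl

/-- Correlations of `φ ∘ S` are asymptotically those of `φ`. -/
theorem tendsto_correlation_sub (hK : ∑ k, (K k)ᴴ * K k = 1)
    (hS : ∀ Λ a, S (incl Λ a) = incl Λ (dualPower Λ K a)) (a b : QuasiLocal d') :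
    Tendsto (fun n => φ.comp S (a * (shift d')^[n] b) - φ (S a * (shift d)^[n] (S b))) atTop
      (𝓝 0) := by
  have h := (φ.continuous.tendsto 0).comp (tendsto_dualMap_mul hK hS a b)
  rw [map_zero] at h
  refine h.congr fun n => ?_
  rw [Function.comp_apply, map_sub]
  rfl

theorem IsStronglyMixingState.comp_dualMap (hK : ∑ k, (K k)ᴴ * K k = 1)
    (hS : ∀ Λ a, S (incl Λ a) = incl Λ (dualPower Λ K a)) (hφ : IsStronglyMixingState φ) :
    IsStronglyMixingState (φ.comp S) where
  isStationaryState := hφ.isStationaryState.comp_dualMap hK hS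
  tendsto a b := by
    have h := (tendsto_correlation_sub (φ := φ) hK hS a b).add (hφ.tendsto (S a) (S b))
    rw [zero_add] at h
    exact h.congr fun n => sub_add_cancel _ _

theorem IsWeaklyMixingState.comp_dualMap (hK : ∑ k, (K k)ᴴ * K k = 1)
    (hS : ∀ Λ a, S (incl Λ a) = incl Λ (dualPower Λ K a)) (hφ : IsWeaklyMixingState φ) :
    IsWeaklyMixingState (φ.comp S) where
  isStationaryState := hφ.isStationaryState.comp_dualMap hK hS
  tendsto a b := by
    have h1 := ((tendsto_add_atTop_iff_nat 1).mpr
      (tendsto_correlation_sub (φ := φ) hK hS a b)).norm.cesaro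
    rw [norm_zero] at h1
    have h2 := h1.add (hφ.tendsto (S a) (S b))
    rw [zero_add] at h2
    refine squeeze_zero (fun n => by positivity) (fun n => ?_) h2
    have hIcc : ∀ u : ℕ → ℝ, ∑ i ∈ Finset.Icc 1 n, u i = ∑ i ∈ Finset.range n, u (i + 1) :=
      fun u => by
        rw [Finset.range_eq_Ico, Finset.sum_Ico_add' u 0 n 1]
        rfl
    rw [hIcc, hIcc, one_div, ← mul_add, ← Finset.sum_add_distrib]
    gcongr with i _
    refine (le_of_eq ?_).trans (norm_add_le _ _)
    congr 1
    simp only [ContinuousLinearMap.comp_apply]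
    ring

theorem IsErgodicState.comp_dualMap (hK : ∑ k, (K k)ᴴ * K k = 1)
    (hS : ∀ Λ a, S (incl Λ a) = incl Λ (dualPower Λ K a)) (hφ : IsErgodicState φ) :
    IsErgodicState (φ.comp S) := by
  have hst' : IsStationaryState (φ.comp S) := IsStationaryState.comp_dualMap hK hS hφ.1
  have hφ' : φ ∈ Set.extremePoints ℝ (invariantStates (shift d)) := by
    rw [invariantStates_shift]
    exact hφ
  have hmem : φ.comp S ∈ invariantStates (shift d') := by
    rw [invariantStates_shift]
    exact hst'
  suffices h : φ.comp S ∈ Set.extremePoints ℝ (invariantStates (shift d')) by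
    rwa [invariantStates_shift] at h
  have h := comp_mem_extremePoints (tendsto_shift_commutator (d := d)) hφ' hmem
  exact h fun a b => tendsto_correlation_sub (φ := φ) hK hS a b

/-! ### Sources -/

theorem IsSource.output {E : Channel d d'} {ρ : Family d}
    (hE : ∀ a, E.toLin a = ∑ k, K k * a * (K k)ᴴ) (hρ : IsSource ρ) : IsSource (E.output ρ) where
  posSemidef m hm := posSemidef_tensorPower hE (hρ.posSemidef m hm)
  trace_eq_one m hm := by
    have h := trace_tensorPower_mul hE (ρ m) 1
    rw [Matrix.mul_one, dualPower_one (sum_kraus_eq_one E hE), Matrix.mul_one,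
      hρ.trace_eq_one m hm] at h
    exact h
  consistent m n hm h a := by
    have h1 := trace_tensorPower_mul hE (ρ m) a
    have h2 := trace_tensorPower_mul hE (ρ n) (ampliate (box_subset h) a)
    rw [dualPower_ampliate (sum_kraus_eq_one E hE), ← hρ.consistent m n hm h] at h2
    exact h1.trans h2.symm

theorem HasDensities.comp_dualMap {E : Channel d d'} {ρ : Family d}
    (hE : ∀ a, E.toLin a = ∑ k, K k * a * (K k)ᴴ)
    (hS : ∀ Λ a, S (incl Λ a) = incl Λ (dualPower Λ K a)) (h : HasDensities φ ρ) :
    HasDensities (φ.comp S) (E.output ρ) := fun m hm a => by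
  rw [ContinuousLinearMap.comp_apply, hS, h m hm]
  exact (trace_tensorPower_mul hE (ρ m) a).symm

theorem IsSource.neZero {ρ : Family d} (hρ : IsSource ρ) : NeZero d := by
  refine ⟨fun h => ?_⟩
  subst h
  have : IsEmpty (box 1 → Fin 0) := ⟨fun x => (x ⟨1, by simp [box]⟩).elim0⟩
  have h1 := hρ.trace_eq_one 1 le_rfl
  simp [Matrix.trace] at h1

theorem Channel.neZero [NeZero d] (E : Channel d d') : NeZero d' := by
  refine ⟨fun h => ?_⟩
  subst h
  have h1 : (E.toLin (Matrix.single 0 0 1)).trace = (Matrix.single (0 : Fin d) 0 (1 : ℂ)).trace :=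
    E.trace_preserving _
  simp [Matrix.trace] at h1

/-- Every property of states that passes to `φ ∘ S` passes to the output source. -/
theorem output_transfer (E : Channel d d') (ρ : Family d) {p : (QuasiLocal d →L[ℂ] ℂ) → Prop}
    {q : (QuasiLocal d' →L[ℂ] ℂ) → Prop}
    (hpq : ∀ {K : Fin d × Fin d' → Matrix (Fin d') (Fin d) ℂ}
      {S : QuasiLocal d' →L[ℂ] QuasiLocal d} {φ : QuasiLocal d →L[ℂ] ℂ},
      ∑ k, (K k)ᴴ * K k = 1 → (∀ Λ a, S (incl Λ a) = incl Λ (dualPower Λ K a)) →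
      p φ → q (φ.comp S)) (h : IsSource ρ ∧ ∃ φ, HasDensities φ ρ ∧ p φ) :
    IsSource (E.output ρ) ∧ ∃ φ, HasDensities φ (E.output ρ) ∧ q φ := by
  obtain ⟨hρ, φ, hφ, hp⟩ := h
  have := hρ.neZero
  have := E.neZero
  obtain ⟨K, hE⟩ := E.exists_kraus
  have hK := sum_kraus_eq_one E hE
  obtain ⟨S, hS⟩ := exists_dualMap hK
  exact ⟨hρ.output hE, φ.comp S, hφ.comp_dualMap hE hS, hpq hK hS hp⟩

end Extension

end SpinChain

end

theorem theorem1 {d d' : ℕ} (E : SpinChain.Channel d d') (ρ : SpinChain.Family d) :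
    (SpinChain.IsStationarySource ρ → SpinChain.IsStationarySource (E.output ρ)) ∧
    (SpinChain.IsErgodicSource ρ → SpinChain.IsErgodicSource (E.output ρ)) ∧
    (SpinChain.IsWeaklyMixingSource ρ → SpinChain.IsWeaklyMixingSource (E.output ρ)) ∧
    (SpinChain.IsStronglyMixingSource ρ → SpinChain.IsStronglyMixingSource (E.output ρ)) :=
  ⟨SpinChain.output_transfer E ρ fun hK hS h => h.comp_dualMap hK hS,
    SpinChain.output_transfer E ρ fun hK hS h => h.comp_dualMap hK hS,
    SpinChain.output_transfer E ρ fun hK hS h => h.comp_dualMap hK hS,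
    SpinChain.output_transfer E ρ fun hK hS h => h.comp_dualMap hK hS⟩
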